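/- Let $\mathbf k$ be a field. Let $\mathcal C$ be a tensor category over $\mathbf k$, that is, a locally presentable $\mathbf k$-linear category with a monoidal structure whose tensor product is $\mathbf k$-linear and cocontinuous in each variable. Call an object $c$ compact-projective if $\operatorname{Hom}(c,-)\colon\mathcal C\to\operatorname{Vect}_{\mathbf k}$ preserves all small colimits, and say that a class of objects generates $\mathcal C$ if $\mathcal C$ is the smallest class of objects which contains it and is closed under isomorphisms and small colimits. Assume that $\mathcal C$ has enough compact projectives: it has all small colimits and is generated by an essentially small class of compact-projective objects. A Deligne–Kelly tensor product $\mathcal C\boxtimes\mathcal C$ is a locally presentable $\mathbf k$-linear category with a functor $\boxtimes\colon\mathcal C\times\mathcal C\to\mathcal C\boxtimes\mathcal C$, linear and cocontinuous in each variable, such that for every locally presentable $\mathbf k$-linear category $\mathcal E$ composition with $\boxtimes$ is an equivalence from the groupoid of cocontinuous linear functors $\mathcal C\boxtimes\mathcal C\to\mathcal E$ and natural isomorphisms to the groupoid of functors $\mathcal C\times\mathcal C\to\mathcal E$ linear and cocontinuous in each variable and natural isomorphisms. It is a $\mathcal C$-$\mathcal C$-bimodule by $c\cdot(x\boxtimes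 y)\cong(c\otimes x)\boxtimes y$ and $(x\boxtimes y)\cdot c\cong x\boxtimes(y\otimes c)$, extended cocontinuously. Let $T\colon\mathcal C\boxtimes\mathcal C\to\mathcal C$ be the cocontinuous linear functor with $T(x\boxtimes y)\cong x\otimes y$; it is a bimodule functor through the isomorphisms $T(c\cdot p)\cong c\otimes T(p)$ and $T(p\cdot c)\cong T(p)\otimes c$ determined by the associativity constraint of $\mathcal C$ on the objects $p=x\boxtimes y$. A right adjoint $T^R$ of $T$ has a canonical lax bimodule structure, with structure maps $c\cdot T^R(m)\to T^R(c\otimes m)$ adjunct to $T(c\cdot T^R(m))\cong c\otimes T(T^R(m))\to c\otimes m$, and $T^R(m)\cdot c\to T^R(m\otimes c)$ adjunct to $T(T^R(m)\cdot c)\cong T(T^R(m))\otimes c\to m\otimes c$; it is called strong if all these maps are invertible. Then a Deligne–Kelly tensor product $\mathcal C\boxtimes\mathcal C$ exists, and for every choice of it the following conditions are equivalent: 1. Every compact-projective object of $\mathcal C$ has a left dual and a right dual. 2. There is a (possibly large) class of compact-projective objects of $\mathcal C$, each having a left dual and a right dual, which generates $\mathcal C$. 3. The multiplication functor $T\colon\mathcal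 C\boxtimes\mathcal C\to\mathcal C$ has a cocontinuous right adjoint $T^R$, and the canonical lax bimodule structure on $T^R$ is strong. -/

import Mathlib

open CategoryTheory CategoryTheory.Limits CategoryTheory.MonoidalCategory

universe v u u₁ u₂ u₃ u₄

namespace TensorCat

section Linear

variable (k : Type v) [Field k]

/-- A cocontinuous `k`-linear functor, i.e. a 1-morphism of the 2-category **Pr** when source and
target are locally presentable `k`-linear categories. -/
structure IsCocontinuous {P : Type u₁} {E : Type u₂} [Category.{v} P] [Category.{v} E]
    [Preadditive P] [Preadditive E] [Linear k P] [Linear k E] (G : P ⥤ E) : Prop where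
  additive : G.Additive
  linear : G.Linear k
  preservesColimits : PreservesColimitsOfSize.{v, v} G

/-- A functor of two variables which is `k`-linear and cocontinuous in each variable. -/
structure IsBicocontinuous {C : Type u₁} {D : Type u₂} {E : Type u₃}
    [Category.{v} C] [Category.{v} D] [Category.{v} E]
    [Preadditive C] [Preadditive D] [Preadditive E] [Linear k C] [Linear k D] [Linear k E]
    (F : C ⥤ D ⥤ E) : Prop where
  left (d : D) : IsCocontinuous k (F.flip.obj d)
  right (c : C) : IsCocontinuous k (F.obj c)

/-- An object `c` is compact-projective if the functor `Hom(c, -)`, with values in `k`-vector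
spaces, commutes with arbitrary small colimits. -/
def IsCompactProjective {C : Type u} [Category.{v} C] [Preadditive C] [Linear k C] (c : C) :
    Prop :=
  PreservesColimitsOfSize.{v, v} ((linearCoyoneda k C).obj (Opposite.op c))

/-- The objects satisfying `S` generate `C` under small colimits: the smallest class of objects
which contains them and is closed under isomorphisms and small colimits is all of `C`. -/
def GeneratesUnderColimits {C : Type u} [Category.{v} C] (S : ObjectProperty C) : Prop :=
  S.colimitsClosure (fun J : Cat.{v, v} => (J : Type v)) = ⊤

/-- `C` has enough compact projectives: it has all small colimits and is generated under small
colimits by an (essentially) small full subcategory of compact-projective objects. -/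
structure HasEnoughCompactProjectives (C : Type u) [Category.{v} C] [Preadditive C] [Linear k C] :
    Prop where
  hasColimits : HasColimitsOfSize.{v, v} C
  exists_generators : ∃ S : ObjectProperty C, ObjectProperty.EssentiallySmall.{v} S ∧
    (∀ c, S c → IsCompactProjective k c) ∧ GeneratesUnderColimits S

/-- A tensor category over `k`: a locally presentable `k`-linear category with a monoidal
structure whose tensor product is `k`-linear and cocontinuous in each variable. -/
class IsTensorCategory (C : Type u) [Category.{v} C] [Preadditive C] [Linear k C]
    [MonoidalCategory C] : Prop where
  locallyPresentable : IsLocallyPresentable.{v} C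
  bicocontinuous : IsBicocontinuous k (curriedTensor C)

end Linear

/-- An object is left and right dualizable if it has both a left dual and a right dual. -/
def IsDualizable {C : Type u} [Category.{v} C] [MonoidalCategory C] (c : C) : Prop :=
  Nonempty (HasLeftDual c) ∧ Nonempty (HasRightDual c)

section DeligneKelly

/-- The bifunctor `(c, d) ↦ G (c ⊠ d)` obtained from `B = ⊠` and a functor `G`. -/
abbrev restrict {C : Type u₁} {D : Type u₂} {P : Type u₃} {E : Type u₄}
    [Category.{v} C] [Category.{v} D] [Category.{v} P] [Category.{v} E]
    (B : C ⥤ D ⥤ P) (G : P ⥤ E) : C ⥤ D ⥤ E :=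
  B ⋙ (Functor.whiskeringRight D P E).obj G

/-- The isomorphism of bifunctors with components `e` at `c ⊠ d`. -/
abbrev restrictIso {C : Type u₁} {D : Type u₂} {P : Type u₃} {E : Type u₄}
    [Category.{v} C] [Category.{v} D] [Category.{v} P] [Category.{v} E]
    (B : C ⥤ D ⥤ P) {G G' : P ⥤ E} (e : G ≅ G') : restrict B G ≅ restrict B G' :=
  Functor.isoWhiskerLeft B ((Functor.whiskeringRight D P E).mapIso e)

/-- The universal property of the Deligne–Kelly tensor product: `B : C × D → P` is linear and
cocontinuous in each variable, and for every locally presentable `k`-linear category `E`,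
composition with `B` is an equivalence from the groupoid of cocontinuous linear functors
`P ⥤ E` to the groupoid of functors `C × D → E` linear and cocontinuous in each variable.
The equivalence is spelled out as essential surjectivity and full faithfulness. -/
structure IsDeligneKelly (k : Type v) [Field k] {C D P : Type (v + 1)}
    [Category.{v} C] [Category.{v} D] [Category.{v} P] [Preadditive C] [Preadditive D]
    [Preadditive P] [Linear k C] [Linear k D] [Linear k P] (B : C ⥤ D ⥤ P) : Prop where
  bicocontinuous : IsBicocontinuous k B
  exists_extension {E : Type (v + 1)} [Category.{v} E] [Preadditive E] [Linear k E]
    [IsLocallyPresentable.{v} E] (F : C ⥤ D ⥤ E) (hF : IsBicocontinuous k F) :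
    ∃ G : P ⥤ E, IsCocontinuous k G ∧ Nonempty (restrict B G ≅ F)
  bijective_restrictIso {E : Type (v + 1)} [Category.{v} E] [Preadditive E] [Linear k E]
    [IsLocallyPresentable.{v} E] (G G' : P ⥤ E) (hG : IsCocontinuous k G)
    (hG' : IsCocontinuous k G') :
    Function.Bijective (fun e : G ≅ G' => restrictIso B e)

/-- A Deligne–Kelly tensor product `C ⊠ D`: a locally presentable `k`-linear category `obj` with a
universal bifunctor `box`, `(c, d) ↦ c ⊠ d`. -/
structure DeligneKellyProduct (k : Type v) [Field k] (C D : Type (v + 1))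
    [Category.{v} C] [Category.{v} D] [Preadditive C] [Preadditive D]
    [Linear k C] [Linear k D] where
  obj : Type (v + 1)
  [category : Category.{v} obj]
  [preadditive : Preadditive obj]
  [linear : Linear k obj]
  [locallyPresentable : IsLocallyPresentable.{v} obj]
  box : C ⥤ D ⥤ obj
  isDeligneKelly : IsDeligneKelly k box

attribute [instance] DeligneKellyProduct.category
  DeligneKellyProduct.preadditive DeligneKellyProduct.linear
attribute [instance] DeligneKellyProduct.locallyPresentable

end DeligneKelly

section Cocontinuous

variable {k : Type v} [Field k]

theorem IsCocontinuous.comp {P : Type u₁} {E : Type u₂} {E' : Type u₃} [Category.{v} P]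
    [Category.{v} E] [Category.{v} E'] [Preadditive P] [Preadditive E] [Preadditive E']
    [Linear k P] [Linear k E] [Linear k E'] {G : P ⥤ E} {H : E ⥤ E'}
    (hG : IsCocontinuous k G) (hH : IsCocontinuous k H) : IsCocontinuous k (G ⋙ H) := by
  obtain ⟨_, _, _⟩ := hG
  obtain ⟨_, _, _⟩ := hH
  exact ⟨inferInstance, inferInstance, inferInstance⟩

end Cocontinuous

namespace DeligneKellyProduct

noncomputable section

variable {k : Type v} [Field k]

section Extension

variable {C D : Type (v + 1)} [Category.{v} C] [Category.{v} D] [Preadditive C] [Preadditive D]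
  [Linear k C] [Linear k D] (P : DeligneKellyProduct k C D)
  {E : Type (v + 1)} [Category.{v} E] [Preadditive E] [Linear k E] [IsLocallyPresentable.{v} E]

/-- The cocontinuous functor `C ⊠ D ⥤ E` induced by a bifunctor `F`. -/
def extend (F : C ⥤ D ⥤ E) (hF : IsBicocontinuous k F) : P.obj ⥤ E :=
  (P.isDeligneKelly.exists_extension F hF).choose

theorem extend_isCocontinuous (F : C ⥤ D ⥤ E) (hF : IsBicocontinuous k F) :
    IsCocontinuous k (P.extend F hF) :=
  (P.isDeligneKelly.exists_extension F hF).choose_spec.1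

/-- The isomorphism `(P.extend F) (c ⊠ d) ≅ F (c, d)`. -/
def extendIso (F : C ⥤ D ⥤ E) (hF : IsBicocontinuous k F) :
    restrict P.box (P.extend F hF) ≅ F :=
  (P.isDeligneKelly.exists_extension F hF).choose_spec.2.some

/-- The unique isomorphism of cocontinuous functors on `C ⊠ D` with prescribed components at the
objects `c ⊠ d`. -/
def liftIso {G G' : P.obj ⥤ E} (hG : IsCocontinuous k G) (hG' : IsCocontinuous k G')
    (e : restrict P.box G ≅ restrict P.box G') : G ≅ G' :=
  ((P.isDeligneKelly.bijective_restrictIso G G' hG hG').2 e).choose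

theorem restrictIso_liftIso {G G' : P.obj ⥤ E} (hG : IsCocontinuous k G)
    (hG' : IsCocontinuous k G') (e : restrict P.box G ≅ restrict P.box G') :
    restrictIso P.box (P.liftIso hG hG' e) = e :=
  ((P.isDeligneKelly.bijective_restrictIso G G' hG hG').2 e).choose_spec

end Extension

section Multiplication

variable {C : Type (v + 1)} [Category.{v} C] [Preadditive C] [Linear k C] [MonoidalCategory C]

variable (k) in
theorem isCocontinuous_tensorLeft [IsTensorCategory k C] (c : C) :
    IsCocontinuous k (tensorLeft c) :=
  (IsTensorCategory.bicocontinuous (k := k) (C := C)).right c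

variable (k) in
theorem isCocontinuous_tensorRight [IsTensorCategory k C] (c : C) :
    IsCocontinuous k (tensorRight c) :=
  (IsTensorCategory.bicocontinuous (k := k) (C := C)).left c

variable [IsTensorCategory k C] (P : DeligneKellyProduct k C C)

/-- The multiplication functor `T : C ⊠ C ⥤ C`, with `T (x ⊠ y) ≅ x ⊗ y`. -/
def mul : P.obj ⥤ C :=
  haveI : IsLocallyPresentable.{v} C := IsTensorCategory.locallyPresentable k
  P.extend (curriedTensor C) IsTensorCategory.bicocontinuous

theorem mul_isCocontinuous : IsCocontinuous k P.mul :=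
  haveI : IsLocallyPresentable.{v} C := IsTensorCategory.locallyPresentable k
  P.extend_isCocontinuous (curriedTensor C) IsTensorCategory.bicocontinuous

/-- The isomorphism `T (x ⊠ y) ≅ x ⊗ y`. -/
def mulIso : restrict P.box P.mul ≅ curriedTensor C :=
  haveI : IsLocallyPresentable.{v} C := IsTensorCategory.locallyPresentable k
  P.extendIso (curriedTensor C) IsTensorCategory.bicocontinuous

/-- The bifunctor `(x, y) ↦ (c ⊗ x) ⊠ y`. -/
abbrev leftBox (c : C) : C ⥤ C ⥤ P.obj := tensorLeft c ⋙ P.box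

/-- The bifunctor `(x, y) ↦ x ⊠ (y ⊗ c)`. -/
abbrev rightBox (c : C) : C ⥤ C ⥤ P.obj :=
  P.box ⋙ (Functor.whiskeringLeft C C P.obj).obj (tensorRight c)

theorem leftBox_isBicocontinuous (c : C) : IsBicocontinuous k (P.leftBox c) where
  left d := (isCocontinuous_tensorLeft k c).comp (P.isDeligneKelly.bicocontinuous.left d)
  right d := P.isDeligneKelly.bicocontinuous.right (c ⊗ d)

theorem rightBox_isBicocontinuous (c : C) : IsBicocontinuous k (P.rightBox c) where
  left d := P.isDeligneKelly.bicocontinuous.left (d ⊗ c)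
  right d := (isCocontinuous_tensorRight k c).comp (P.isDeligneKelly.bicocontinuous.right d)

/-- The left action of `c : C` on `C ⊠ C`, with `c • (x ⊠ y) ≅ (c ⊗ x) ⊠ y`. -/
def actLeft (c : C) : P.obj ⥤ P.obj := P.extend (P.leftBox c) (P.leftBox_isBicocontinuous c)

/-- The right action of `c : C` on `C ⊠ C`, with `(x ⊠ y) • c ≅ x ⊠ (y ⊗ c)`. -/
def actRight (c : C) : P.obj ⥤ P.obj := P.extend (P.rightBox c) (P.rightBox_isBicocontinuous c)

/-- The isomorphism `c • (x ⊠ y) ≅ (c ⊗ x) ⊠ y`. -/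
def actLeftIso (c : C) : restrict P.box (P.actLeft c) ≅ P.leftBox c :=
  P.extendIso (P.leftBox c) (P.leftBox_isBicocontinuous c)

/-- The isomorphism `(x ⊠ y) • c ≅ x ⊠ (y ⊗ c)`. -/
def actRightIso (c : C) : restrict P.box (P.actRight c) ≅ P.rightBox c :=
  P.extendIso (P.rightBox c) (P.rightBox_isBicocontinuous c)

theorem actLeft_isCocontinuous (c : C) : IsCocontinuous k (P.actLeft c) :=
  P.extend_isCocontinuous _ _

theorem actRight_isCocontinuous (c : C) : IsCocontinuous k (P.actRight c) :=
  P.extend_isCocontinuous _ _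

/-- The associator as an isomorphism between the bifunctors `(c ⊗ x) ⊗ y` and `c ⊗ (x ⊗ y)`
of `(x, y)`. -/
def assocLeft (c : C) : tensorLeft c ⋙ curriedTensor C ≅
    curriedTensor C ⋙ (Functor.whiskeringRight C C C).obj (tensorLeft c) :=
  NatIso.ofComponents (fun x => NatIso.ofComponents (fun y => α_ c x y))

/-- The inverse associator as an isomorphism between the bifunctors `x ⊗ (y ⊗ c)` and
`(x ⊗ y) ⊗ c` of `(x, y)`. -/
def assocRight (c : C) : curriedTensor C ⋙ (Functor.whiskeringLeft C C C).obj (tensorRight c) ≅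
    curriedTensor C ⋙ (Functor.whiskeringRight C C C).obj (tensorRight c) :=
  NatIso.ofComponents (fun x => NatIso.ofComponents (fun y => (α_ x y c).symm))

/-- The composite
`T (c • (x ⊠ y)) ≅ T ((c ⊗ x) ⊠ y) ≅ (c ⊗ x) ⊗ y ≅ c ⊗ (x ⊗ y) ≅ c ⊗ T (x ⊠ y)`. -/
def mulActLeftBoxIso (c : C) :
    restrict P.box (P.actLeft c ⋙ P.mul) ≅ restrict P.box (P.mul ⋙ tensorLeft c) :=
  (Functor.isoWhiskerRight (P.actLeftIso c) ((Functor.whiskeringRight C P.obj C).obj P.mul) :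
    restrict P.box (P.actLeft c ⋙ P.mul) ≅ tensorLeft c ⋙ restrict P.box P.mul) ≪≫
  Functor.isoWhiskerLeft (tensorLeft c) P.mulIso ≪≫ assocLeft c ≪≫
  (Functor.isoWhiskerRight P.mulIso.symm ((Functor.whiskeringRight C C C).obj (tensorLeft c)) :
    curriedTensor C ⋙ (Functor.whiskeringRight C C C).obj (tensorLeft c) ≅
      restrict P.box (P.mul ⋙ tensorLeft c))

/-- The composite
`T ((x ⊠ y) • c) ≅ T (x ⊠ (y ⊗ c)) ≅ x ⊗ (y ⊗ c) ≅ (x ⊗ y) ⊗ c ≅ T (x ⊠ y) ⊗ c`. -/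
def mulActRightBoxIso (c : C) :
    restrict P.box (P.actRight c ⋙ P.mul) ≅ restrict P.box (P.mul ⋙ tensorRight c) :=
  (Functor.isoWhiskerRight (P.actRightIso c) ((Functor.whiskeringRight C P.obj C).obj P.mul) :
    restrict P.box (P.actRight c ⋙ P.mul) ≅
      restrict P.box P.mul ⋙ (Functor.whiskeringLeft C C C).obj (tensorRight c)) ≪≫
  Functor.isoWhiskerRight P.mulIso ((Functor.whiskeringLeft C C C).obj (tensorRight c)) ≪≫
  assocRight c ≪≫
  (Functor.isoWhiskerRight P.mulIso.symm ((Functor.whiskeringRight C C C).obj (tensorRight c)) :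
    curriedTensor C ⋙ (Functor.whiskeringRight C C C).obj (tensorRight c) ≅
      restrict P.box (P.mul ⋙ tensorRight c))

/-- The left module functor structure `T (c • p) ≅ c ⊗ T p` of the multiplication functor. -/
def mulActLeftIso (c : C) : P.actLeft c ⋙ P.mul ≅ P.mul ⋙ tensorLeft c :=
  haveI : IsLocallyPresentable.{v} C := IsTensorCategory.locallyPresentable k
  P.liftIso ((P.actLeft_isCocontinuous c).comp P.mul_isCocontinuous)
    (P.mul_isCocontinuous.comp (isCocontinuous_tensorLeft k c)) (P.mulActLeftBoxIso c)

/-- The right module functor structure `T (p • c) ≅ T p ⊗ c` of the multiplication functor. -/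
def mulActRightIso (c : C) : P.actRight c ⋙ P.mul ≅ P.mul ⋙ tensorRight c :=
  haveI : IsLocallyPresentable.{v} C := IsTensorCategory.locallyPresentable k
  P.liftIso ((P.actRight_isCocontinuous c).comp P.mul_isCocontinuous)
    (P.mul_isCocontinuous.comp (isCocontinuous_tensorRight k c)) (P.mulActRightBoxIso c)

/-- The lax left module structure map `c • R m ⟶ R (c ⊗ m)` of a right adjoint `R` of `T`: the
adjunct of `T (c • R m) ≅ c ⊗ T (R m) ⟶ c ⊗ m`. -/
def laxLeft {P : DeligneKellyProduct k C C} {R : C ⥤ P.obj} (adj : P.mul ⊣ R) (c m : C) :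
    (P.actLeft c).obj (R.obj m) ⟶ R.obj (c ⊗ m) :=
  adj.homEquiv _ _ ((P.mulActLeftIso c).hom.app (R.obj m) ≫ c ◁ adj.counit.app m)

/-- The lax right module structure map `R m • c ⟶ R (m ⊗ c)` of a right adjoint `R` of `T`: the
adjunct of `T (R m • c) ≅ T (R m) ⊗ c ⟶ m ⊗ c`. -/
def laxRight {P : DeligneKellyProduct k C C} {R : C ⥤ P.obj} (adj : P.mul ⊣ R) (c m : C) :
    (P.actRight c).obj (R.obj m) ⟶ R.obj (m ⊗ c) :=
  adj.homEquiv _ _ ((P.mulActRightIso c).hom.app (R.obj m) ≫ adj.counit.app m ▷ c)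

/-- The multiplication functor `T : C ⊠ C ⥤ C` has a cocontinuous right adjoint `R` whose canonical
lax `C`-`C`-bimodule structure is strong, i.e. has invertible structure maps. -/
def HasStrongRightAdjoint : Prop :=
  ∃ (R : C ⥤ P.obj) (adj : P.mul ⊣ R), PreservesColimitsOfSize.{v, v} R ∧
    (∀ c m : C, IsIso (laxLeft adj c m)) ∧ (∀ c m : C, IsIso (laxRight adj c m))

end Multiplication

end

end DeligneKellyProduct

end TensorCat

/-! Existence. For a small family of compact-projective generators `o i`, a model of C ⊠ C is the
category of presheaves of vector spaces on pairs (i, j), bilinear in morphisms, with x ⊠ y the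
presheaf Hom(o i, x) ⊗ Hom(o j, y). A bifunctor F extends along ⊠ by the left adjoint of the nerve e
↦ Hom(F(o i, o j), e) (`exists_extension_boxModel`). Natural isomorphisms extend because the objects
c ⊠ z, for c and z in the family, are compact-projective generators with Hom(c ⊠ z, x ⊠ y) = Hom(c,
x) ⊗ Hom(z, y); this is `IsBoxDense`. Every Deligne–Kelly product is equivalent to such a model, and
any two compact projectives may be added to the family, so density holds in every product for all
compact projectives (`DeligneKellyProduct.isBoxDense`).

From 2 to 3. The adjoint functor theorem gives T a right adjoint R. If c has a left dual and z is
compact-projective, then T(c ⊠ z) ≅ c ⊗ z is compact-projective, since c ⊗ - has a cocontinuous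
right adjoint; as such objects c ⊠ z generate, R is cocontinuous. When c has duals, its action on C
⊠ C and on C has a left adjoint, namely the action of a dual, and the lax structure map at c is a
mate of a transformation which is an associator on the objects x ⊠ y, hence invertible
(`isIso_mate`, `BoxAction.isIso_lax_of_adjunction`). Both sides of the lax map are cocontinuous in
c, so invertibility spreads from generators to all c (`BoxAction.isIso_lax_of_generates`).

From 3 to 1. For c compact-projective let H be the right adjoint of c ⊠ -. Density gives that H(a ⊠
y) is a coproduct of copies of y indexed by a basis of Hom(c, a), so H commutes with the right
action (`BoxAction.isIso_boxHomMap`). With h = H(R(𝟙)) this yields Hom(x, h ⊗ d) ≅ Hom(c ⊠ x, R(𝟙) ·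
d) ≅ Hom(c ⊠ x, R(𝟙 ⊗ d)) ≅ Hom(c ⊗ x, 𝟙 ⊗ d), given by a pairing c ⊗ h ⟶ 𝟙; this forces h to be a
left dual. Exchanging the two variables gives the right dual.

The implication from 1 to 2 takes S to be any generating class of compact projectives. -/

namespace TensorCat

open TensorProduct Opposite

/-! ### Induction along colimits from a generating class. -/

section Generation

variable {C : Type u} [Category.{v} C]

/-- Induction principle for a class of objects generating under colimits. -/
theorem GeneratesUnderColimits.induction {S : ObjectProperty C} (hS : GeneratesUnderColimits S)
    {Q : ObjectProperty C} (mem : ∀ c, S c → Q c)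
    (colim : ∀ (J : Type v) [SmallCategory J] (F : J ⥤ C) (s : Cocone F), IsColimit s →
      (∀ j, Q (F.obj j)) → Q s.pt) (x : C) : Q x := by
  have hx : S.colimitsClosure (fun J : Cat.{v, v} => (J : Type v)) x := by
    rw [show _ = _ from hS]; trivial
  induction hx with
  | of_mem X hX => exact mem X hX
  | @of_isoClosure X Y e _ hX =>
    -- An isomorphic object is a colimit of a constant one-object diagram, so `colim` also covers
    -- closure under isomorphisms.
    have hs : IsColimit (Cocone.mk (F := (Functor.const (Discrete PUnit.{v + 1})).obj X) Y
        { app := fun _ => e.hom }) :=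
      { desc := fun s => e.inv ≫ s.ι.app ⟨⟨⟩⟩
        fac := fun s j => by simp
        uniq := fun s m hm => by simp [← hm ⟨⟨⟩⟩] }
    exact colim _ _ _ hs (fun _ => hX)
  | @of_colimitPresentation X J pres _ h => exact colim J _ _ pres.isColimit h

theorem generatesUnderColimits_of_forall {S : ObjectProperty C}
    (h : ∀ x, S.colimitsClosure (fun J : Cat.{v, v} => (J : Type v)) x) :
    GeneratesUnderColimits S := by
  ext x; simp [h x]

/-- A class is generating if every object of a generating class lies in its closure. -/
theorem GeneratesUnderColimits.of_closure {S S' : ObjectProperty C}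
    (hS : GeneratesUnderColimits S)
    (h : ∀ c, S c → S'.colimitsClosure (fun J : Cat.{v, v} => (J : Type v)) c) :
    GeneratesUnderColimits S' :=
  generatesUnderColimits_of_forall
    (hS.induction h (fun J _ _ s hs h =>
      ObjectProperty.colimitsClosure.of_colimitPresentation (a := Cat.of J) ⟨_, s.ι, hs⟩ h))

theorem GeneratesUnderColimits.mono {S S' : ObjectProperty C}
    (hS : GeneratesUnderColimits S) (h : S ≤ S') : GeneratesUnderColimits S' :=
  hS.of_closure fun c hc => .of_mem c (h c hc)

/-- The image of the closure of `S` under a cocontinuous functor lies in the closure of any class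
whose closure contains the image of `S`. -/
theorem GeneratesUnderColimits.map_closure {E : Type u₁} [Category.{v} E] {S : ObjectProperty C}
    (hS : GeneratesUnderColimits S) {S' : ObjectProperty E} (F : C ⥤ E)
    [PreservesColimitsOfSize.{v, v} F]
    (h : ∀ c, S c → S'.colimitsClosure (fun J : Cat.{v, v} => (J : Type v)) (F.obj c)) (x : C) :
    S'.colimitsClosure (fun J : Cat.{v, v} => (J : Type v)) (F.obj x) :=
  hS.induction (Q := fun x => S'.colimitsClosure _ (F.obj x)) h (fun J _ D s hs h =>
    ObjectProperty.colimitsClosure.of_colimitPresentation (a := Cat.of J)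
      ⟨D ⋙ F, (F.mapCocone s).ι, isColimitOfPreserves (J := J) F hs⟩ h) x

/-- The maps from `S` to `x` become jointly epimorphic after `F`: the objects `x` with this property
are closed under colimits. Maps out of objects built by induction are compared this way. -/
theorem GeneratesUnderColimits.hom_ext {E : Type u₁} [Category.{v} E] {S : ObjectProperty C}
    (hS : GeneratesUnderColimits S) (F : C ⥤ E) [PreservesColimitsOfSize.{v, v} F] {x : C} {e : E}
    {f g : F.obj x ⟶ e} (h : ∀ c, S c → ∀ w : c ⟶ x, F.map w ≫ f = F.map w ≫ g) : f = g :=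
  hS.induction (Q := fun x => ∀ f g : F.obj x ⟶ e,
      (∀ c, S c → ∀ w : c ⟶ x, F.map w ≫ f = F.map w ≫ g) → f = g)
    (fun c hc f g h => by simpa using h c hc (𝟙 c))
    (fun J _ D s hs ih f g h => by
      refine (isColimitOfPreserves F hs).hom_ext fun j => ih j _ _ fun c hc w => ?_
      simpa using h c hc (w ≫ s.ι.app j)) x f g h

theorem GeneratesUnderColimits.natTrans_ext {E : Type u₁} [Category.{v} E] {S : ObjectProperty C}
    (hS : GeneratesUnderColimits S) {F G : C ⥤ E} [PreservesColimitsOfSize.{v, v} F]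
    {α β : F ⟶ G} (h : ∀ c, S c → α.app c = β.app c) : α = β := by
  ext x
  exact hS.hom_ext F fun c hc w => by simp [h c hc]

/-- Over a colimit, the component is the map of colimits induced by the components on the diagram.
-/
theorem GeneratesUnderColimits.isIso_app {E : Type u₁} [Category.{v} E] {S : ObjectProperty C}
    (hS : GeneratesUnderColimits S) {F G : C ⥤ E} [PreservesColimitsOfSize.{v, v} F]
    [PreservesColimitsOfSize.{v, v} G] (α : F ⟶ G) (h : ∀ c, S c → IsIso (α.app c)) (x : C) :
    IsIso (α.app x) :=
  hS.induction (Q := fun x => IsIso (α.app x)) h (fun J _ D s hs ih => by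
    have : IsIso (Functor.whiskerLeft D α) :=
      (NatTrans.isIso_iff_isIso_app _).2 ih
    have hF := isColimitOfPreserves F hs
    have hG := isColimitOfPreserves G hs
    have : α.app s.pt =
        (IsColimit.coconePointsIsoOfNatIso hF hG (asIso (Functor.whiskerLeft D α))).hom :=
      hF.hom_ext fun j => by
        rw [IsColimit.coconePointsIsoOfNatIso_hom, IsColimit.ι_map]
        simp
    rw [this]; infer_instance) x

/-- The objects `z` for which composition with `f` is bijective on Hom(z, -) are closed under
colimits; at `z = y` and `z = x` this gives the inverse. -/
theorem GeneratesUnderColimits.isIso {S : ObjectProperty C}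
    (hS : GeneratesUnderColimits S) {x y : C} (f : x ⟶ y)
    (h : ∀ c, S c → Function.Bijective (fun g : c ⟶ x => g ≫ f)) : IsIso f := by
  have key : ∀ z : C, Function.Bijective (fun g : z ⟶ x => g ≫ f) := by
    refine hS.induction (Q := fun z => Function.Bijective (fun g : z ⟶ x => g ≫ f)) h ?_
    intro J _ D s hs ih
    refine ⟨fun g g' hg => hs.hom_ext fun j => (ih j).1 ?_, fun g => ?_⟩
    · simpa using congrArg (fun t => s.ι.app j ≫ t) hg
    · choose l hl using fun j => (ih j).2 (s.ι.app j ≫ g)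
      dsimp at hl
      refine ⟨hs.desc ⟨x, ⟨l, fun i j a => (ih i).1 ?_⟩⟩, hs.hom_ext fun j => ?_⟩
      · dsimp
        rw [Category.assoc, hl, Category.comp_id, hl, ← Category.assoc, s.w]
      · simp [hl]
  obtain ⟨g, hg⟩ := (key y).2 (𝟙 y)
  exact ⟨g, (key x).1 (by simp [show g ≫ f = 𝟙 y from hg]), hg⟩

end Generation

/-! ### Compact-projective objects and adjunctions. -/

section CompactProjective

variable {k : Type v} [Field k] {C : Type u} [Category.{v} C] [Preadditive C] [Linear k C]

/-- Morphisms from a compact-projective object to a colimit are spanned by those which factor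
through the diagram. -/
theorem IsCompactProjective.eq_top_of_isColimit {c : C} (hc : IsCompactProjective k c)
    {J : Type v} [SmallCategory J] {F : J ⥤ C} {s : Cocone F} (hs : IsColimit s)
    (N : Submodule k (c ⟶ s.pt)) (hN : ∀ j (f : c ⟶ F.obj j), f ≫ s.ι.app j ∈ N) : N = ⊤ := by
  have : PreservesColimitsOfSize.{v, v} ((linearCoyoneda k C).obj (Opposite.op c)) := hc
  have h := isColimitOfPreserves ((linearCoyoneda k C).obj (Opposite.op c)) hs
  -- Hom(c, s.pt) is the colimit of the modules Hom(c, F j), so the projection modulo `N`, which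
  -- kills every leg, is zero.
  have h0 : (ModuleCat.ofHom N.mkQ : ModuleCat.of k (c ⟶ s.pt) ⟶ _) = 0 := by
    refine h.hom_ext fun j => ?_
    ext f
    exact (Submodule.Quotient.mk_eq_zero N).2 (hN j f)
  rw [← Submodule.ker_mkQ N, show N.mkQ = 0 from congrArg ModuleCat.Hom.hom h0]
  exact LinearMap.ker_zero

theorem IsCompactProjective.of_iso {c c' : C} (hc : IsCompactProjective k c) (e : c ≅ c') :
    IsCompactProjective k c' :=
  haveI : PreservesColimitsOfSize.{v, v} ((linearCoyoneda k C).obj (Opposite.op c)) := hc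
  preservesColimits_of_natIso ((linearCoyoneda k C).mapIso e.symm.op)

variable {D : Type u₁} [Category.{v} D] [Preadditive D] [Linear k D]

theorem linear_leftAdjoint {L : C ⥤ D} {R : D ⥤ C} (adj : L ⊣ R) [R.Linear k] :
    L.Linear k where
  map_smul f r := by
    apply (adj.homEquiv _ _).injective
    simp [Adjunction.homEquiv_unit]

variable (k) in
/-- The `k`-linear form of the hom-set bijection of an adjunction. -/
def linearCoyonedaIso {L : C ⥤ D} {R : D ⥤ C} (adj : L ⊣ R) [L.Additive] [L.Linear k] (c : C) :
    R ⋙ (linearCoyoneda k C).obj (Opposite.op c) ≅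
      (linearCoyoneda k D).obj (Opposite.op (L.obj c)) :=
  haveI : R.Additive := adj.right_adjoint_additive
  NatIso.ofComponents (fun d => LinearEquiv.toModuleIso
    { toFun := fun f => (adj.homEquiv c d).symm f
      invFun := fun f => adj.homEquiv c d f
      map_add' := fun f g => by simp [Adjunction.homEquiv_counit]
      map_smul' := fun r f => by simp [Adjunction.homEquiv_counit]
      left_inv := fun f => by simp
      right_inv := fun f => by simp }) (fun f => by
        ext g
        exact adj.homEquiv_naturality_right_symm g f)

/-- A left adjoint of a cocontinuous functor preserves compact-projective objects. -/
theorem IsCompactProjective.map {L : C ⥤ D} {R : D ⥤ C} (adj : L ⊣ R) [L.Additive] [L.Linear k]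
    [PreservesColimitsOfSize.{v, v} R] {c : C} (hc : IsCompactProjective k c) :
    IsCompactProjective k (L.obj c) :=
  haveI : PreservesColimitsOfSize.{v, v} ((linearCoyoneda k C).obj (Opposite.op c)) := hc
  preservesColimits_of_natIso (linearCoyonedaIso k adj c)

/-- A right adjoint is cocontinuous if its left adjoint maps generating compact-projective objects
to compact-projective objects. -/
theorem preservesColimits_rightAdjoint {L : C ⥤ D} {R : D ⥤ C} (adj : L ⊣ R) [L.Additive]
    [L.Linear k] [HasColimitsOfSize.{v, v} C] {S : ObjectProperty C}
    (hS : GeneratesUnderColimits S) (h : ∀ c, S c → IsCompactProjective k c)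
    (h' : ∀ c, S c → IsCompactProjective k (L.obj c)) : PreservesColimitsOfSize.{v, v} R where
  preservesColimitsOfShape {J _} := ⟨fun {F} => ⟨fun {s} hs => by
    have ht := colimit.isColimit (F ⋙ R)
    -- The comparison map colim R(F j) ⟶ R(s.pt) is tested on Hom(c, -) for `c` in `S`. As `c` and
    -- `L c` are compact-projective, source and target both become the colimit of Hom(c, R(F j)) ≅
    -- Hom(L c, F j).
    suffices IsIso (ht.desc (R.mapCocone s)) from ⟨IsColimit.ofPointIso ht⟩
    refine hS.isIso _ fun c hc => ?_
    have : PreservesColimitsOfSize.{v, v} ((linearCoyoneda k C).obj (Opposite.op c)) := h c hc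
    have : PreservesColimitsOfSize.{v, v} ((linearCoyoneda k D).obj (Opposite.op (L.obj c))) :=
      h' c hc
    have : PreservesColimitsOfSize.{v, v} (R ⋙ (linearCoyoneda k C).obj (Opposite.op c)) :=
      preservesColimits_of_natIso (linearCoyonedaIso k adj c).symm
    have h1 := isColimitOfPreserves ((linearCoyoneda k C).obj (Opposite.op c)) ht
    have h2 := isColimitOfPreserves (R ⋙ (linearCoyoneda k C).obj (Opposite.op c)) hs
    have e (j : J) (g : c ⟶ R.obj (F.obj j)) :
        CategoryStruct.comp (Y := colimit (F ⋙ R)) (g ≫ colimit.ι (F ⋙ R) j)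
          (ht.desc (R.mapCocone s)) = g ≫ R.map (s.ι.app j) :=
      (Category.assoc _ _ _).trans (congrArg (fun t => g ≫ t) (ht.fac (R.mapCocone s) j))
    have h3 : ((linearCoyoneda k C).obj (Opposite.op c)).map (ht.desc (R.mapCocone s)) =
        (h1.coconePointUniqueUpToIso h2).hom := h1.hom_ext fun j => by
      rw [IsColimit.comp_coconePointUniqueUpToIso_hom]
      ext g
      exact e j g
    have h4 : IsIso (((linearCoyoneda k C).obj (Opposite.op c)).map
        (ht.desc (R.mapCocone s))) := by
      rw [h3]; infer_instance
    exact ConcreteCategory.bijective_of_isIso (((linearCoyoneda k C).obj (Opposite.op c)).map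
      (ht.desc (R.mapCocone s)))⟩⟩

end CompactProjective

/-! ### The adjoint functor theorem for locally presentable categories. -/

section AdjointFunctor

variable {C : Type u} [Category.{v} C] {E : Type u₁} [Category.{v} E]

theorem hasColimits_of_isLocallyPresentable (C : Type u) [Category.{v} C]
    [IsLocallyPresentable.{v} C] : HasColimitsOfSize.{v, v} C := by
  obtain ⟨κ, _, _⟩ := IsLocallyPresentable.exists_cardinal.{v} C
  infer_instance

/-- A cocontinuous functor on a locally presentable category is a left adjoint. -/
theorem isLeftAdjoint_of_isLocallyPresentable [IsLocallyPresentable.{v} C] (F : C ⥤ E)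
    [PreservesColimitsOfSize.{v, v} F] : F.IsLeftAdjoint := by
  obtain ⟨κ, _, _⟩ := IsLocallyPresentable.exists_cardinal.{v} C
  obtain ⟨S, _, hS⟩ := HasCardinalFilteredGenerator.exists_small_generator C κ
  have := preservesLimits_op F
  suffices F.op.IsRightAdjoint from
    ⟨_, ⟨(Adjunction.ofIsRightAdjoint F.op).unop⟩⟩
  refine isRightAdjoint_of_preservesLimits_of_solutionSetCondition F.op fun Y => ?_
  -- The solution set has one element: the colimit of the small family of arrows F(s) ⟶ Y with `s`
  -- in a small generator. It is weakly terminal, because each X is a colimit of objects of the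
  -- generator and the corresponding colimit legs glue to a map out of X.
  let T : ObjectProperty (CostructuredArrow F Y.unop) := S.inverseImage (CostructuredArrow.proj _ _)
  have : ObjectProperty.Small.{v} T := by
    dsimp [T]; infer_instance
  have : HasColimit T.ι := by
    have := hasColimitsOfShape_of_essentiallySmall.{v} T.FullSubcategory C
    have : PreservesColimitsOfShape T.FullSubcategory F :=
      preservesColimitsOfShape_of_equiv (equivSmallModel.{v} T.FullSubcategory).symm F
    infer_instance
  refine ⟨PUnit, fun _ => .op (colimit T.ι).left, fun _ => (colimit T.ι).hom.op,
    fun X h => ⟨⟨⟩, ?_⟩⟩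
  obtain ⟨J, _, _, ⟨p⟩⟩ := hS.exists_colimitsOfShape X.unop
  let t (j : J) : T.FullSubcategory :=
    ⟨CostructuredArrow.mk (F.map (p.ι.app j) ≫ h.unop), p.prop_diag_obj j⟩
  let a {i j : J} (f : i ⟶ j) : t i ⟶ t j :=
    ObjectProperty.homMk (CostructuredArrow.homMk (p.diag.map f) (by
      have := p.ι.naturality f
      simp [t, ← F.map_comp_assoc] at this ⊢))
  let g : X.unop ⟶ (colimit T.ι).left := p.isColimit.desc
    ⟨_, { app := fun j => (colimit.ι T.ι (t j)).left
          naturality := fun i j f => by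
            have := congrArg CommaMorphism.left (colimit.w T.ι (a f))
            simpa [a] using this }⟩
  refine ⟨g.op, Quiver.Hom.unop_inj ?_⟩
  refine (isColimitOfPreserves F p.isColimit).hom_ext fun j => ?_
  have h1 : p.ι.app j ≫ g = (colimit.ι T.ι (t j)).left := p.isColimit.fac _ j
  have h2 := CostructuredArrow.w (colimit.ι T.ι (t j))
  dsimp at h2 ⊢
  rw [← F.map_comp_assoc, h1, h2]
  rfl

end AdjointFunctor

/-! ### The model of C ⊠ C by bilinear presheaves. -/

section Model

variable (k : Type v) [Field k] {C : Type u} [Category.{v} C] [Preadditive C] [Linear k C]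
  {ι : Type v} (o : ι → C)

/-- Pairs of indices of a family `o` of objects, with pairs of morphisms as morphisms. -/
structure GenPair (o : ι → C) : Type v where
  /-- The first index. -/
  left : ι
  /-- The second index. -/
  right : ι

instance : Category.{v} (GenPair o) where
  Hom p q := (o p.1 ⟶ o q.1) × (o p.2 ⟶ o q.2)
  id p := (𝟙 _, 𝟙 _)
  comp f g := (f.1 ≫ g.1, f.2 ≫ g.2)

variable {o} in
/-- The morphism of pairs given by two morphisms. -/
def GenPair.hom {p q : GenPair o} (f : o p.1 ⟶ o q.1) (g : o p.2 ⟶ o q.2) : p ⟶ q := (f, g)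

/-- Presheaves of vector spaces on pairs which are bilinear on morphisms. -/
structure IsBilinearPresheaf (X : (GenPair o)ᵒᵖ ⥤ ModuleCat.{v} k) : Prop where
  add_left {p q : GenPair o} (f f' : o p.1 ⟶ o q.1) (g : o p.2 ⟶ o q.2) :
    X.map (GenPair.hom (f + f') g).op = X.map (GenPair.hom f g).op + X.map (GenPair.hom f' g).op
  add_right {p q : GenPair o} (f : o p.1 ⟶ o q.1) (g g' : o p.2 ⟶ o q.2) :
    X.map (GenPair.hom f (g + g')).op = X.map (GenPair.hom f g).op + X.map (GenPair.hom f g').op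
  smul_left {p q : GenPair o} (r : k) (f : o p.1 ⟶ o q.1) (g : o p.2 ⟶ o q.2) :
    X.map (GenPair.hom (r • f) g).op = r • X.map (GenPair.hom f g).op
  smul_right {p q : GenPair o} (r : k) (f : o p.1 ⟶ o q.1) (g : o p.2 ⟶ o q.2) :
    X.map (GenPair.hom f (r • g)).op = r • X.map (GenPair.hom f g).op

/-- Bilinear presheaves as an object property. -/
def bilinearPresheaf : ObjectProperty ((GenPair o)ᵒᵖ ⥤ ModuleCat.{v} k) := IsBilinearPresheaf k o

/-- The category of bilinear presheaves. -/
abbrev BilinearPresheaf := (bilinearPresheaf k o).FullSubcategory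

omit [Preadditive C] [Linear k C] in
theorem isColimit_evaluation_hom_ext {J : Type v} [SmallCategory J]
    {F : J ⥤ (GenPair o)ᵒᵖ ⥤ ModuleCat.{v} k} {s : Cocone F} (hs : IsColimit s)
    {p : (GenPair o)ᵒᵖ} {M : ModuleCat.{v} k} {f g : s.pt.obj p ⟶ M}
    (h : ∀ j, (s.ι.app j).app p ≫ f = (s.ι.app j).app p ≫ g) : f = g :=
  (isColimitOfPreserves ((evaluation _ _).obj p) hs).hom_ext h

/-- Colimits of presheaves are pointwise, and the bilinearity equations concern maps out of a
pointwise colimit, where they can be checked on the legs. -/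
instance (J : Type v) [SmallCategory J] :
    (bilinearPresheaf k o).IsClosedUnderColimitsOfShape J where
  colimitsOfShape_le := by
    rintro X ⟨p⟩
    have hp := p.prop_diag_obj
    exact
    { add_left := fun f f' g => isColimit_evaluation_hom_ext k o p.isColimit fun j => by
        simpa [(hp j).add_left] using (p.ι.app j).naturality (GenPair.hom (f + f') g).op |>.symm
      add_right := fun f f' g => isColimit_evaluation_hom_ext k o p.isColimit fun j => by
        simpa [(hp j).add_right] using (p.ι.app j).naturality (GenPair.hom f (f' + g)).op |>.symm
      smul_left := fun r f g => isColimit_evaluation_hom_ext k o p.isColimit fun j => by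
        simpa [(hp j).smul_left] using (p.ι.app j).naturality (GenPair.hom (r • f) g).op |>.symm
      smul_right := fun r f g => isColimit_evaluation_hom_ext k o p.isColimit fun j => by
        simpa [(hp j).smul_right] using
          (p.ι.app j).naturality (GenPair.hom f (r • g)).op |>.symm }

instance : HasColimitsOfSize.{v, v} (BilinearPresheaf k o) :=
  ⟨fun _ _ => inferInstance⟩

instance : PreservesColimitsOfSize.{v, v} (bilinearPresheaf k o).ι :=
  ⟨inferInstance⟩

/-- Evaluation of a bilinear presheaf at a pair. -/
abbrev evalPair (p : GenPair o) : BilinearPresheaf k o ⥤ ModuleCat.{v} k :=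
  (bilinearPresheaf k o).ι ⋙ (evaluation _ _).obj (op p)

/-- Colimits of bilinear presheaves can be checked after evaluation. -/
theorem preservesColimits_of_evalPair {D : Type u₁} [Category.{v} D]
    (F : D ⥤ BilinearPresheaf k o)
    (h : ∀ p, PreservesColimitsOfSize.{v, v} (F ⋙ evalPair k o p)) :
    PreservesColimitsOfSize.{v, v} F where
  preservesColimitsOfShape {J _} := ⟨fun {K} => ⟨fun {s} hs => by
    refine ⟨isColimitOfReflects (bilinearPresheaf k o).ι
      (evaluationJointlyReflectsColimits _ fun p => ?_)⟩
    exact isColimitOfPreserves (F ⋙ evalPair k o p.unop) hs⟩⟩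

/-- The presheaf `(i, j) ↦ Hom(o i, x) ⊗ Hom(o j, y)`. -/
def boxPresheaf (x y : C) : (GenPair o)ᵒᵖ ⥤ ModuleCat.{v} k where
  obj p := ModuleCat.of k ((o p.unop.1 ⟶ x) ⊗[k] (o p.unop.2 ⟶ y))
  map f := ModuleCat.ofHom
    (TensorProduct.map (Linear.leftComp k x f.unop.1) (Linear.leftComp k y f.unop.2))
  map_id p := by
    ext f g
    exact congrArg₂ (fun a b => a ⊗ₜ[k] b) (Category.id_comp f) (Category.id_comp g)
  map_comp a b := by
    ext f g
    exact congrArg₂ (fun a b => a ⊗ₜ[k] b) (Category.assoc _ _ f) (Category.assoc _ _ g)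

theorem isBilinearPresheaf_boxPresheaf (x y : C) :
    bilinearPresheaf k o (boxPresheaf k o x y) where
  add_left f f' g := by
    refine ModuleCat.hom_ext (TensorProduct.ext' fun u w => ?_)
    exact (congrArg (fun a => a ⊗ₜ[k] (g ≫ w)) (Preadditive.add_comp _ _ _ f f' u)).trans
      (TensorProduct.add_tmul _ _ _)
  add_right f g g' := by
    refine ModuleCat.hom_ext (TensorProduct.ext' fun u w => ?_)
    exact (congrArg (fun a => (f ≫ u) ⊗ₜ[k] a) (Preadditive.add_comp _ _ _ g g' w)).trans
      (TensorProduct.tmul_add _ _ _)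
  smul_left r f g := by
    refine ModuleCat.hom_ext (TensorProduct.ext' fun u w => ?_)
    exact (congrArg (fun a => a ⊗ₜ[k] (g ≫ w)) (Linear.smul_comp _ _ _ r f u)).trans
      (TensorProduct.smul_tmul' _ _ _).symm
  smul_right r f g := by
    refine ModuleCat.hom_ext (TensorProduct.ext' fun u w => ?_)
    exact (congrArg (fun a => (f ≫ u) ⊗ₜ[k] a) (Linear.smul_comp _ _ _ r g w)).trans
      (TensorProduct.tmul_smul _ _ _)

/-- The universal bifunctor with values in bilinear presheaves. -/
def boxModel : C ⥤ C ⥤ BilinearPresheaf k o where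
  obj x :=
    { obj := fun y => ⟨boxPresheaf k o x y, isBilinearPresheaf_boxPresheaf k o x y⟩
      map := fun {y y'} g => ObjectProperty.homMk
        { app := fun p => ModuleCat.ofHom (TensorProduct.map LinearMap.id (Linear.rightComp k _ g))
          naturality := fun p q f => by
            refine ModuleCat.hom_ext (TensorProduct.ext' fun a b => ?_)
            exact congrArg (fun t => (f.unop.1 ≫ a) ⊗ₜ[k] t) (Category.assoc _ b g) }
      map_id := fun y => by
        refine ObjectProperty.hom_ext _ (NatTrans.ext (funext fun p =>
          ModuleCat.hom_ext (TensorProduct.ext' fun a b => ?_)))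
        exact congrArg (fun t => a ⊗ₜ[k] t) (Category.comp_id b)
      map_comp := fun f g => by
        refine ObjectProperty.hom_ext _ (NatTrans.ext (funext fun p =>
          ModuleCat.hom_ext (TensorProduct.ext' fun a b => ?_)))
        exact congrArg (fun t => a ⊗ₜ[k] t) (Category.assoc b f g).symm }
  map {x x'} f :=
    { app := fun y => ObjectProperty.homMk
        { app := fun p => ModuleCat.ofHom (TensorProduct.map (Linear.rightComp k _ f) LinearMap.id)
          naturality := fun p q g => by
            refine ModuleCat.hom_ext (TensorProduct.ext' fun a b => ?_)
            exact congrArg (fun t => t ⊗ₜ[k] (g.unop.2 ≫ b)) (Category.assoc _ a f) }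
      naturality := fun y y' g => by
        refine ObjectProperty.hom_ext _ (NatTrans.ext (funext fun p =>
          ModuleCat.hom_ext (TensorProduct.ext' fun a b => ?_)))
        rfl }
  map_id x := by
    ext y p : 5
    refine ModuleCat.hom_ext (TensorProduct.ext' fun a b => ?_)
    exact congrArg (fun t => t ⊗ₜ[k] b) (Category.comp_id a)
  map_comp f g := by
    ext y p : 5
    refine ModuleCat.hom_ext (TensorProduct.ext' fun a b => ?_)
    exact congrArg (fun t => t ⊗ₜ[k] b) (Category.assoc a f g).symm

end Model

/-! ### Tensor products of morphism spaces. -/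

section BoxTensor

variable {k : Type v} [Field k] {C : Type u} [Category.{v} C] [Preadditive C] [Linear k C]
  {D : Type u₁} [Category.{v} D] [Preadditive D] [Linear k D]
  {P : Type u₂} [Category.{v} P] [Preadditive P] [Linear k P] {B : C ⥤ D ⥤ P}

/-- The map `Hom(c, x) ⊗ Hom(z, y) → Hom(c ⊠ z, x ⊠ y)` of a bilinear bifunctor. -/
noncomputable def boxTensor (hB : IsBicocontinuous k B) (c x : C) (z y : D) :
    (c ⟶ x) ⊗[k] (z ⟶ y) →ₗ[k] ((B.obj c).obj z ⟶ (B.obj x).obj y) :=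
  TensorProduct.lift (LinearMap.mk₂ k (fun f g => (B.map f).app z ≫ (B.obj x).map g)
    (fun f f' g => by
      have := (hB.left z).additive
      have h := (B.flip.obj z).map_add (f := f) (g := f')
      dsimp at h
      simp [h])
    (fun r f g => by
      have := (hB.left z).linear
      have := (hB.left z).additive
      have h := (B.flip.obj z).map_smul r f
      dsimp at h
      simp [h])
    (fun f g g' => by
      have := (hB.right x).additive
      simp [(B.obj x).map_add])
    (fun r f g => by
      have := (hB.right x).linear
      have := (hB.right x).additive
      simp [(B.obj x).map_smul]))

@[simp]
theorem boxTensor_tmul (hB : IsBicocontinuous k B) {c x : C} {z y : D} (f : c ⟶ x) (g : z ⟶ y) :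
    boxTensor hB c x z y (f ⊗ₜ g) = (B.map f).app z ≫ (B.obj x).map g := rfl

end BoxTensor

/-! ### Cocontinuity, the Yoneda lemma and generators in the model. -/

section Model

variable {k : Type v} [Field k] {C : Type u} [Category.{v} C] [Preadditive C] [Linear k C]
  {ι : Type v} {o : ι → C}

/-- Evaluated at a pair, either variable enters through Hom(o i, -) followed by tensoring with a
fixed vector space; the first is cocontinuous because `o i` is compact-projective. -/
theorem isBicocontinuous_boxModel (ho : ∀ i, IsCompactProjective k (o i)) :
    IsBicocontinuous k (boxModel k o) where
  left y :=
    { additive := ⟨fun {x x' f f'} => by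
        refine ObjectProperty.hom_ext _ (NatTrans.ext (funext fun p =>
          ModuleCat.hom_ext (TensorProduct.ext' fun a b => ?_)))
        exact (congrArg (fun t => t ⊗ₜ[k] b) (Preadditive.comp_add _ _ _ a f f')).trans
          (TensorProduct.add_tmul _ _ _)⟩
      linear := ⟨fun {x x'} f r => by
        refine ObjectProperty.hom_ext _ (NatTrans.ext (funext fun p =>
          ModuleCat.hom_ext (TensorProduct.ext' fun a b => ?_)))
        exact (congrArg (fun t => t ⊗ₜ[k] b) (Linear.comp_smul _ _ _ a r f)).trans
          (TensorProduct.smul_tmul' _ _ _).symm⟩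
      preservesColimits := preservesColimits_of_evalPair k o _ fun p => by
        have : PreservesColimitsOfSize.{v, v} ((linearCoyoneda k C).obj (op (o p.1))) := ho p.1
        exact inferInstanceAs (PreservesColimitsOfSize.{v, v}
          ((linearCoyoneda k C).obj (op (o p.1)) ⋙
            tensorRight (ModuleCat.of k (o p.2 ⟶ y)))) }
  right x :=
    { additive := ⟨fun {y y' f f'} => by
        refine ObjectProperty.hom_ext _ (NatTrans.ext (funext fun p =>
          ModuleCat.hom_ext (TensorProduct.ext' fun a b => ?_)))
        exact (congrArg (fun t => a ⊗ₜ[k] t) (Preadditive.comp_add _ _ _ b f f')).trans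
          (TensorProduct.tmul_add _ _ _)⟩
      linear := ⟨fun {y y'} f r => by
        refine ObjectProperty.hom_ext _ (NatTrans.ext (funext fun p =>
          ModuleCat.hom_ext (TensorProduct.ext' fun a b => ?_)))
        exact (congrArg (fun t => a ⊗ₜ[k] t) (Linear.comp_smul _ _ _ b r f)).trans
          (TensorProduct.tmul_smul _ _ _)⟩
      preservesColimits := preservesColimits_of_evalPair k o _ fun p => by
        have : PreservesColimitsOfSize.{v, v} ((linearCoyoneda k C).obj (op (o p.2))) := ho p.2
        exact inferInstanceAs (PreservesColimitsOfSize.{v, v}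
          ((linearCoyoneda k C).obj (op (o p.2)) ⋙
            tensorLeft (ModuleCat.of k (o p.1 ⟶ x)))) }

variable (k o) in
/-- The representable bilinear presheaf of a pair. -/
abbrev boxGen (p : GenPair o) : BilinearPresheaf k o := ((boxModel k o).obj (o p.1)).obj (o p.2)

/-- The universal element of the representable bilinear presheaf of a pair. -/
def boxGenId (p : GenPair o) : (boxGen k o p).obj.obj (op p) := 𝟙 (o p.1) ⊗ₜ[k] 𝟙 (o p.2)

/-- The morphism from a representable bilinear presheaf given by an element. -/
def boxGenDesc (p : GenPair o) (X : BilinearPresheaf k o) (x : X.obj.obj (op p)) :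
    boxGen k o p ⟶ X :=
  ObjectProperty.homMk
    { app := fun q => ModuleCat.ofHom (TensorProduct.lift (LinearMap.mk₂ k
        (fun f g => (X.obj.map (GenPair.hom (p := q.unop) f g).op).hom x)
        (fun f f' g => by rw [X.property.add_left]; rfl)
        (fun r f g => by rw [X.property.smul_left]; rfl)
        (fun f g g' => by rw [X.property.add_right]; rfl)
        (fun r f g => by rw [X.property.smul_right]; rfl)))
      naturality := fun q r f => ModuleCat.hom_ext (TensorProduct.ext' fun a b =>
        congrArg (fun t => t.hom x) (X.obj.map_comp (GenPair.hom (p := q.unop) a b).op f)) }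

/-- The element a ⊗ b is the restriction along (a, b) of the universal element, and pure tensors
span. -/
theorem boxGen_hom_ext {p : GenPair o} {X : BilinearPresheaf k o} {f g : boxGen k o p ⟶ X}
    (h : (f.hom.app (op p)).hom (boxGenId p) = (g.hom.app (op p)).hom (boxGenId p)) : f = g := by
  have key (f : boxGen k o p ⟶ X) (q : (GenPair o)ᵒᵖ) (a : o q.unop.1 ⟶ o p.1)
      (b : o q.unop.2 ⟶ o p.2) : (f.hom.app q).hom (a ⊗ₜ[k] b) =
        (X.obj.map (GenPair.hom (p := q.unop) a b).op).hom ((f.hom.app (op p)).hom (boxGenId p)) :=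
    (congrArg (f.hom.app q).hom (congrArg₂ (fun a b => a ⊗ₜ[k] b)
      (Category.comp_id a).symm (Category.comp_id b).symm)).trans
      (congrArg (fun t => t.hom (boxGenId p))
        (f.hom.naturality (GenPair.hom (p := q.unop) a b).op))
  refine ObjectProperty.hom_ext _ (NatTrans.ext (funext fun q =>
    ModuleCat.hom_ext (TensorProduct.ext' fun a b => ?_)))
  exact (key f q a b).trans ((congrArg _ h).trans (key g q a b).symm)

theorem boxGenDesc_apply (p : GenPair o) (X : BilinearPresheaf k o) (x : X.obj.obj (op p)) :
    ((boxGenDesc p X x).hom.app (op p)).hom (boxGenId p) = x := by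
  change (X.obj.map (𝟙 (op p))).hom x = x
  simp

/-- The Yoneda lemma for bilinear presheaves. -/
def boxGenEquiv (p : GenPair o) (X : BilinearPresheaf k o) :
    (boxGen k o p ⟶ X) ≃ₗ[k] X.obj.obj (op p) where
  toFun f := (f.hom.app (op p)).hom (boxGenId p)
  invFun := boxGenDesc p X
  map_add' _ _ := rfl
  map_smul' _ _ := rfl
  left_inv _ := boxGen_hom_ext (boxGenDesc_apply _ _ _)
  right_inv x := boxGenDesc_apply p X x

/-- By the Yoneda lemma the functor Hom(boxGen p, -) is evaluation at `p`, and colimits of bilinear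
presheaves are pointwise. -/
theorem isCompactProjective_boxGen (p : GenPair o) : IsCompactProjective k (boxGen k o p) :=
  preservesColimits_of_natIso
    (NatIso.ofComponents (fun X => (boxGenEquiv p X).symm.toModuleIso) (fun {X Y} f => by
      ext x
      exact (boxGenEquiv p Y).symm_apply_eq.2
        (congrArg (f.hom.app (op p)).hom (boxGenDesc_apply p X x)).symm) :
      evalPair k o p ≅ (linearCoyoneda k _).obj (op (boxGen k o p)))

/-- Here `boxTensor` is the inverse of the Yoneda isomorphism. -/
theorem bijective_boxTensor_boxModel (ho : ∀ i, IsCompactProjective k (o i)) (i j : ι) (x y : C) :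
    Function.Bijective (boxTensor (isBicocontinuous_boxModel ho) (o i) x (o j) y) := by
  have : boxTensor (isBicocontinuous_boxModel ho) (o i) x (o j) y =
      (boxGenEquiv ⟨i, j⟩ (((boxModel k o).obj x).obj y)).symm.toLinearMap := by
    refine TensorProduct.ext' fun f g => ((LinearEquiv.eq_symm_apply _).2 ?_)
    exact congrArg₂ (fun a b => a ⊗ₜ[k] b) (Category.id_comp f) (Category.id_comp g)
  rw [this]
  exact LinearEquiv.bijective _

variable (k o) in
/-- The class of representable bilinear presheaves. -/
abbrev boxGens : ObjectProperty (BilinearPresheaf k o) := .ofObj (boxGen k o)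

/-- By the Yoneda lemma maps out of the representables see all elements, hence detect equality and
pointwise bijectivity. -/
theorem isStrongGenerator_boxGens : (boxGens k o).IsStrongGenerator := by
  rw [ObjectProperty.isStrongGenerator_iff]
  refine ⟨fun X Y f g h => ?_, fun X Y f _ h => ?_⟩
  · refine ObjectProperty.hom_ext _ (NatTrans.ext (funext fun p => ModuleCat.hom_ext
      (LinearMap.ext fun x => ?_)))
    have := h _ ⟨p.unop⟩ (boxGenDesc p.unop X x)
    have := congrArg (boxGenEquiv p.unop Y) this
    change (f.hom.app p).hom (boxGenEquiv p.unop X (boxGenDesc p.unop X x)) =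
      (g.hom.app p).hom (boxGenEquiv p.unop X (boxGenDesc p.unop X x)) at this
    rwa [show boxGenEquiv p.unop X (boxGenDesc p.unop X x) = x from boxGenDesc_apply _ _ _] at this
  · have key (p : GenPair o) : Function.Bijective (f.hom.app (op p)).hom := by
      have h1 : Function.Bijective fun g : boxGen k o p ⟶ X => g ≫ f :=
        ⟨fun a b hab => (cancel_mono f).1 hab, h _ ⟨p⟩⟩
      have : ⇑(f.hom.app (op p)).hom = boxGenEquiv p Y ∘ (fun g => g ≫ f) ∘
          (boxGenEquiv p X).symm := by
        ext x
        exact congrArg (f.hom.app (op p)).hom (boxGenDesc_apply p X x).symm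
      rw [this]
      exact (boxGenEquiv p Y).bijective.comp (h1.comp (boxGenEquiv p X).symm.bijective)
    have (p : (GenPair o)ᵒᵖ) : IsIso (f.hom.app p) :=
      (ConcreteCategory.isIso_iff_bijective _).2 (key p.unop)
    have : IsIso ((bilinearPresheaf k o).ι.map f) := (NatTrans.isIso_iff_isIso_app _).2 this
    exact isIso_of_reflects_iso f (bilinearPresheaf k o).ι

/-- The forgetful functor from vector spaces to sets preserves filtered colimits, and κ-filtered
categories are filtered. -/
theorem IsCompactProjective.isCardinalPresentable {C : Type u} [Category.{v} C] [Preadditive C]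
    [Linear k C] {c : C} (hc : IsCompactProjective k c) (κ : Cardinal.{v}) [Fact κ.IsRegular] :
    IsCardinalPresentable c κ where
  preservesColimitOfShape J _ _ := by
    have : PreservesColimitsOfSize.{v, v} ((linearCoyoneda k C).obj (op c)) := hc
    have := isFiltered_of_isCardinalFiltered J κ
    exact inferInstanceAs (PreservesColimitsOfShape J
      ((linearCoyoneda k C).obj (op c) ⋙ forget (ModuleCat.{v} k)))

instance : IsLocallyPresentable.{v} (BilinearPresheaf k o) where
  exists_cardinal := ⟨Cardinal.aleph0, Cardinal.fact_isRegular_aleph0, by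
    have := Cardinal.fact_isRegular_aleph0.{v}
    rw [IsCardinalLocallyPresentable.iff_exists_isStrongGenerator]
    refine ⟨boxGens k o, inferInstance, isStrongGenerator_boxGens, ?_⟩
    rintro _ ⟨p⟩
    exact (isCompactProjective_boxGen p).isCardinalPresentable _⟩

/-- A strong generator of finitely presentable objects has a dense closure under finite colimits, so
every object is a filtered colimit of finite colimits of representables. -/
theorem generatesUnderColimits_boxGens : GeneratesUnderColimits (boxGens k o) := by
  have := Cardinal.fact_isRegular_aleph0.{v}
  have hp : boxGens k o ≤ isCardinalPresentable _ Cardinal.aleph0.{v} := by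
    rintro _ ⟨p⟩
    exact (isCompactProjective_boxGen p).isCardinalPresentable _
  have := (isStrongGenerator_boxGens (k := k) (o := o)).isDense_colimitsCardinalClosure_ι hp
  refine generatesUnderColimits_of_forall fun X => ?_
  obtain ⟨J, _, _, ⟨h⟩⟩ := (IsCardinalFilteredGenerator.of_isDense_ι _ Cardinal.aleph0.{v}
    ((boxGens k o).colimitsCardinalClosure_le_isCardinalPresentable hp)).exists_colimitsOfShape X
  refine .of_colimitPresentation (a := Cat.of J) h.toColimitPresentation fun j => ?_
  exact ObjectProperty.colimitsCardinalClosure_le _ _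
    (fun J _ _ => inferInstanceAs (ObjectProperty.IsClosedUnderColimitsOfShape _ (Cat.of J)))
    (ObjectProperty.le_colimitsClosure _ _) _ (h.prop_diag_obj j)

end Model

/-! ### Density of the objects c ⊠ z and extension of natural transformations. -/

section BoxDense

variable (k : Type v) [Field k] {C : Type u} [Category.{v} C] [Preadditive C] [Linear k C]
  {P : Type u₁} [Category.{v} P] [Preadditive P] [Linear k P]

/-- The objects `c ⊠ z` with `c` and `z` in `S`. -/
inductive boxObjects (S : ObjectProperty C) (B : C ⥤ C ⥤ P) : ObjectProperty P
  | mk (c z : C) (hc : S c) (hz : S z) : boxObjects S B ((B.obj c).obj z)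

/-- A bicocontinuous bifunctor `B = ⊠` is dense on `S` if the objects `c ⊠ z` with `c` and `z` in
`S` are compact-projective generators, and `Hom(c, x) ⊗ Hom(z, y) → Hom(c ⊠ z, x ⊠ y)` is
bijective for these `c` and `z`. -/
structure IsBoxDense (S : ObjectProperty C) (B : C ⥤ C ⥤ P) : Prop where
  bicocontinuous : IsBicocontinuous k B
  isCompactProjective {c z : C} (hc : S c) (hz : S z) :
    IsCompactProjective k ((B.obj c).obj z)
  bijective {c z : C} (hc : S c) (hz : S z) (x y : C) :
    Function.Bijective (boxTensor bicocontinuous c x z y)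
  generates : GeneratesUnderColimits (boxObjects S B)

variable {k} {S : ObjectProperty C} {B : C ⥤ C ⥤ P} {E : Type u₂} [Category.{v} E]

/-- Natural transformations from a cocontinuous functor are determined by their components at the
objects `x ⊠ y`. -/
theorem IsBoxDense.natTrans_ext (hB : IsBoxDense k S B) {G G' : P ⥤ E}
    [PreservesColimitsOfSize.{v, v} G] {φ ψ : G ⟶ G'}
    (h : ∀ x y, φ.app ((B.obj x).obj y) = ψ.app ((B.obj x).obj y)) : φ = ψ :=
  hB.generates.natTrans_ext (by rintro _ ⟨x, y, _, _⟩; exact h x y)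

variable [Preadditive E] [Linear k E]

variable (k) in
/-- The morphisms compatible with given components of two linear functors. -/
def naturalSubmodule (G G' : P ⥤ E) [G.Additive] [G.Linear k] [G'.Additive] [G'.Linear k] {p q : P}
    (a : G.obj p ⟶ G'.obj p) (b : G.obj q ⟶ G'.obj q) : Submodule k (p ⟶ q) where
  carrier := { f | G.map f ≫ b = a ≫ G'.map f }
  zero_mem' := by simp
  add_mem' := by
    intro f g hf hg
    simp_all [G.map_add, G'.map_add]
  smul_mem' := by
    intro r f hf
    simp_all [G.map_smul, G'.map_smul]

theorem mem_naturalSubmodule {G G' : P ⥤ E} [G.Additive] [G.Linear k] [G'.Additive]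
    [G'.Linear k] {p q : P} {a : G.obj p ⟶ G'.obj p} {b : G.obj q ⟶ G'.obj q} {f : p ⟶ q} :
    f ∈ naturalSubmodule k G G' a b ↔ G.map f ≫ b = a ≫ G'.map f := Iff.rfl

/-- The condition on `f` is linear and Hom(c ⊠ z, x ⊠ y) is spanned by pure tensors, for which it is
naturality of `α` in each variable. -/
theorem IsBoxDense.naturality (hB : IsBoxDense k S B) {G G' : P ⥤ E} [G.Additive] [G.Linear k]
    [G'.Additive] [G'.Linear k] (α : restrict B G ⟶ restrict B G') {c z x y : C} (hc : S c)
    (hz : S z) (f : (B.obj c).obj z ⟶ (B.obj x).obj y) :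
    G.map f ≫ (α.app x).app y = (α.app c).app z ≫ G'.map f := by
  obtain ⟨t, rfl⟩ := (hB.bijective hc hz x y).2 f
  rw [← mem_naturalSubmodule (k := k)]
  induction t with
  | zero => simp
  | add a b ha hb => rw [map_add]; exact add_mem ha hb
  | tmul f g =>
    have h1 := (α.app x).naturality g
    have h2 := congrArg (fun t => t.app z) (α.naturality f)
    dsimp at h1 h2
    rw [boxTensor_tmul, mem_naturalSubmodule, Functor.map_comp, Functor.map_comp, Category.assoc,
      h1, reassoc_of% h2]

/-- The component is glued along colimits. Prescribing it on all maps from generators c ⊠ z makes it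
unique, and this is what makes the chosen components compatible with the diagram at each colimit. -/
theorem IsBoxDense.exists_component (hB : IsBoxDense k S B) {G G' : P ⥤ E}
    [G.Additive] [G.Linear k] [PreservesColimitsOfSize.{v, v} G]
    [G'.Additive] [G'.Linear k] (α : restrict B G ⟶ restrict B G') (p : P) :
    ∃ φ : G.obj p ⟶ G'.obj p, ∀ c z, S c → S z →
      ∀ f : (B.obj c).obj z ⟶ p, G.map f ≫ φ = (α.app c).app z ≫ G'.map f := by
  refine hB.generates.induction (Q := fun p => ∃ φ : G.obj p ⟶ G'.obj p, ∀ c z, S c → S z →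
    ∀ f : (B.obj c).obj z ⟶ p, G.map f ≫ φ = (α.app c).app z ≫ G'.map f) ?_ ?_ p
  · rintro _ ⟨x, y, hx, hy⟩
    exact ⟨(α.app x).app y, fun c z hc hz => hB.naturality α hc hz⟩
  · intro J _ D s hs ih
    choose φ hφ using ih
    let t : Cocone (D ⋙ G) := ⟨G'.obj s.pt,
      { app := fun j => φ j ≫ G'.map (s.ι.app j)
        naturality := fun i j f => hB.generates.hom_ext G (by
          rintro _ ⟨c, z, hc, hz⟩ w
          have h1 := hφ i c z hc hz w
          have h2 := hφ j c z hc hz (w ≫ D.map f)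
          have h3 := s.w f
          dsimp at h3 ⊢
          rw [Category.comp_id, reassoc_of% h1, ← G.map_comp_assoc, reassoc_of% h2,
            ← G'.map_comp, ← G'.map_comp, Category.assoc, h3]) }⟩
    have hφ' (j : J) : G.map (s.ι.app j) ≫ (isColimitOfPreserves G hs).desc t =
        φ j ≫ G'.map (s.ι.app j) := (isColimitOfPreserves G hs).fac t j
    refine ⟨(isColimitOfPreserves G hs).desc t, fun c z hc hz f => ?_⟩
    -- A map from c ⊠ z to the colimit need not factor through the diagram, but by
    -- compact-projectivity it is a linear combination of maps that do.
    have : naturalSubmodule k G G' ((α.app c).app z) ((isColimitOfPreserves G hs).desc t) = ⊤ :=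
      (hB.isCompactProjective hc hz).eq_top_of_isColimit hs _ fun j f => by
        rw [mem_naturalSubmodule, G.map_comp, Category.assoc, hφ',
          reassoc_of% (hφ j c z hc hz f), G'.map_comp]
    exact mem_naturalSubmodule.1 (this.symm ▸ Submodule.mem_top)

/-- Natural transformations between cocontinuous functors extend from the objects `x ⊠ y`. -/
theorem IsBoxDense.exists_lift (hB : IsBoxDense k S B) {G G' : P ⥤ E} (hG : IsCocontinuous k G)
    [G'.Additive] [G'.Linear k] (α : restrict B G ⟶ restrict B G') :
    ∃ φ : G ⟶ G', ∀ x y, φ.app ((B.obj x).obj y) = (α.app x).app y := by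
  obtain ⟨_, _, _⟩ := hG
  choose φ hφ using hB.exists_component α
  refine ⟨⟨φ, fun p q f => hB.generates.hom_ext G ?_⟩, fun x y => hB.generates.hom_ext G ?_⟩
  · rintro _ ⟨c, z, hc, hz⟩ w
    have h1 := hφ q c z hc hz (w ≫ f)
    have h2 := hφ p c z hc hz w
    rw [← G.map_comp_assoc, h1, reassoc_of% h2, G'.map_comp]
  · rintro _ ⟨c, z, hc, hz⟩ w
    exact (hφ _ c z hc hz w).trans (hB.naturality α hc hz w).symm

/-- Natural transformations between cocontinuous functors are the same as natural transformations
between the bifunctors they induce. -/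
theorem IsBoxDense.bijective_restrictIso (hB : IsBoxDense k S B) {G G' : P ⥤ E}
    (hG : IsCocontinuous k G) (hG' : IsCocontinuous k G') :
    Function.Bijective (fun e : G ≅ G' => restrictIso B e) := by
  obtain ⟨_, _, _⟩ := id hG
  obtain ⟨_, _, _⟩ := id hG'
  refine ⟨fun e e' h => Iso.ext (hB.natTrans_ext fun x y =>
    congrArg (fun t => (t.hom.app x).app y) h), fun e => ?_⟩
  obtain ⟨φ, hφ⟩ := hB.exists_lift hG e.hom
  obtain ⟨ψ, hψ⟩ := hB.exists_lift hG' e.inv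
  refine ⟨⟨φ, ψ, hB.natTrans_ext fun x y => ?_, hB.natTrans_ext fun x y => ?_⟩, ?_⟩
  · simp only [NatTrans.comp_app, hφ, hψ]
    exact congrArg (fun t => (t.app x).app y) e.hom_inv_id
  · simp only [NatTrans.comp_app, hφ, hψ]
    exact congrArg (fun t => (t.app x).app y) e.inv_hom_id
  · ext x y
    exact hφ x y

end BoxDense

/-! ### The universal property of the model. -/

section Model

variable {k : Type v} [Field k] {C : Type u} [Category.{v} C] [Preadditive C] [Linear k C]
  {ι : Type v} {o : ι → C}

theorem isBoxDense_boxModel (ho : ∀ i, IsCompactProjective k (o i)) :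
    IsBoxDense k (.ofObj o) (boxModel k o) where
  bicocontinuous := isBicocontinuous_boxModel ho
  isCompactProjective := by
    rintro _ _ ⟨i⟩ ⟨j⟩
    exact isCompactProjective_boxGen ⟨i, j⟩
  bijective := by
    rintro _ _ ⟨i⟩ ⟨j⟩ x y
    exact bijective_boxTensor_boxModel ho i j x y
  generates := generatesUnderColimits_boxGens.mono (by
    rintro _ ⟨p⟩
    exact .mk _ _ ⟨_⟩ ⟨_⟩)

variable {E : Type u₂} [Category.{v} E] [Preadditive E] [Linear k E] {F : C ⥤ C ⥤ E}

variable (o) in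
/-- The presheaf `(i, j) ↦ Hom(F (o i, o j), e)`. -/
def boxNerveObj (F : C ⥤ C ⥤ E) (e : E) : (GenPair o)ᵒᵖ ⥤ ModuleCat.{v} k where
  obj p := ModuleCat.of k ((F.obj (o p.unop.1)).obj (o p.unop.2) ⟶ e)
  map {p q} f := ModuleCat.ofHom (Linear.leftComp k e
    ((F.map f.unop.1).app (o q.unop.2) ≫ (F.obj (o p.unop.1)).map f.unop.2))
  map_id p := ModuleCat.hom_ext (LinearMap.ext fun (g : (F.obj _).obj _ ⟶ e) =>
    show ((F.map (𝟙 _)).app _ ≫ (F.obj _).map (𝟙 _)) ≫ g = g by simp)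
  map_comp {p q r} f f' := ModuleCat.hom_ext (LinearMap.ext fun (g : (F.obj _).obj _ ⟶ e) =>
    show ((F.map (f'.unop.1 ≫ f.unop.1)).app _ ≫ (F.obj _).map (f'.unop.2 ≫ f.unop.2)) ≫ g =
      ((F.map f'.unop.1).app _ ≫ (F.obj _).map f'.unop.2) ≫
        ((F.map f.unop.1).app _ ≫ (F.obj _).map f.unop.2) ≫ g by simp)

theorem isBilinearPresheaf_boxNerveObj (hF : IsBicocontinuous k F) (e : E) :
    bilinearPresheaf k o (boxNerveObj o F e) where
  add_left {p q} f f' g := ModuleCat.hom_ext (LinearMap.ext fun (h : (F.obj _).obj _ ⟶ e) =>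
    show ((F.map (f + f')).app _ ≫ (F.obj _).map g) ≫ h =
      ((F.map f).app _ ≫ (F.obj _).map g) ≫ h + ((F.map f').app _ ≫ (F.obj _).map g) ≫ h by
    have := (hF.left (o p.2)).additive
    have h := (F.flip.obj (o p.2)).map_add (f := f) (g := f')
    dsimp at h
    simp [h])
  add_right {p q} f g g' := ModuleCat.hom_ext (LinearMap.ext fun (h : (F.obj _).obj _ ⟶ e) =>
    show ((F.map f).app _ ≫ (F.obj _).map (g + g')) ≫ h =
      ((F.map f).app _ ≫ (F.obj _).map g) ≫ h + ((F.map f).app _ ≫ (F.obj _).map g') ≫ h by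
    have := (hF.right (o q.1)).additive
    simp [(F.obj (o q.1)).map_add])
  smul_left {p q} r f g := ModuleCat.hom_ext (LinearMap.ext fun (h : (F.obj _).obj _ ⟶ e) =>
    show ((F.map (r • f)).app _ ≫ (F.obj _).map g) ≫ h =
      r • (((F.map f).app _ ≫ (F.obj _).map g) ≫ h) by
    have := (hF.left (o p.2)).linear
    have := (hF.left (o p.2)).additive
    have h := (F.flip.obj (o p.2)).map_smul r f
    dsimp at h
    simp [h])
  smul_right {p q} r f g := ModuleCat.hom_ext (LinearMap.ext fun (h : (F.obj _).obj _ ⟶ e) =>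
    show ((F.map f).app _ ≫ (F.obj _).map (r • g)) ≫ h =
      r • (((F.map f).app _ ≫ (F.obj _).map g) ≫ h) by
    have := (hF.right (o q.1)).linear
    have := (hF.right (o q.1)).additive
    simp [(F.obj (o q.1)).map_smul])

variable (o) in
/-- The functor `e ↦ ((i, j) ↦ Hom(F (o i, o j), e))`. -/
def boxNerve (hF : IsBicocontinuous k F) : E ⥤ BilinearPresheaf k o where
  obj e := ⟨boxNerveObj o F e, isBilinearPresheaf_boxNerveObj hF e⟩
  map g := ObjectProperty.homMk
    { app := fun _ => ModuleCat.ofHom (Linear.rightComp k _ g)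
      naturality := fun _ _ _ => ModuleCat.hom_ext (LinearMap.ext fun h =>
        Category.assoc _ h g) }
  map_id _ := ObjectProperty.hom_ext _ (NatTrans.ext (funext fun _ =>
    ModuleCat.hom_ext (LinearMap.ext fun h => Category.comp_id h)))
  map_comp f g := ObjectProperty.hom_ext _ (NatTrans.ext (funext fun _ =>
    ModuleCat.hom_ext (LinearMap.ext fun h => (Category.assoc h f g).symm)))

instance (hF : IsBicocontinuous k F) : (boxNerve o hF).Additive where
  map_add {_ _ f g} := ObjectProperty.hom_ext _ (NatTrans.ext (funext fun _ =>
    ModuleCat.hom_ext (LinearMap.ext fun h => Preadditive.comp_add _ _ _ h f g)))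

instance (hF : IsBicocontinuous k F) : (boxNerve o hF).Linear k where
  map_smul f r := ObjectProperty.hom_ext _ (NatTrans.ext (funext fun _ =>
    ModuleCat.hom_ext (LinearMap.ext fun h => Linear.comp_smul _ _ _ h r f)))

/-- On the representable at (i, j) the left adjoint is defined, with value F(o i, o j), by the
Yoneda lemma; since `E` has colimits, the objects where it is defined are closed under colimits. -/
theorem isRightAdjoint_boxNerve [HasColimitsOfSize.{v, v} E] (hF : IsBicocontinuous k F) :
    (boxNerve o hF).IsRightAdjoint := by
  refine Functor.isRightAdjoint_of_leftAdjointObjIsDefined_eq_top ?_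
  ext X
  simp only [Pi.top_apply, Prop.top_eq_true, iff_true]
  refine generatesUnderColimits_boxGens.induction
    (Q := (boxNerve o hF).leftAdjointObjIsDefined) ?_ ?_ X
  · rintro _ ⟨p⟩
    exact Functor.CorepresentableBy.isCorepresentable (X := (F.obj (o p.1)).obj (o p.2))
      { homEquiv := fun {e} => (boxGenEquiv p ((boxNerve o hF).obj e)).symm.toEquiv
        homEquiv_comp := fun {e e'} g f => (boxGenEquiv p ((boxNerve o hF).obj e')).symm_apply_eq.2
          (congrArg (fun t => t ≫ g) (boxGenDesc_apply p ((boxNerve o hF).obj e) f)).symm }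
  · intro J _ D s hs h
    exact Functor.leftAdjointObjIsDefined_of_isColimit hs h

/-- The canonical map from `x ⊠ y` to the nerve of `F (x, y)`. -/
noncomputable def boxNerveUnit (hF : IsBicocontinuous k F) (x y : C) :
    ((boxModel k o).obj x).obj y ⟶ (boxNerve o hF).obj ((F.obj x).obj y) :=
  ObjectProperty.homMk
    { app := fun p => ModuleCat.ofHom (boxTensor hF (o p.unop.1) x (o p.unop.2) y)
      naturality := fun p q f => ModuleCat.hom_ext (TensorProduct.ext' fun a b => by
        change (F.map (f.unop.1 ≫ a)).app _ ≫ (F.obj _).map (f.unop.2 ≫ b) =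
          ((F.map f.unop.1).app _ ≫ (F.obj _).map f.unop.2) ≫ (F.map a).app _ ≫ (F.obj _).map b
        simp) }

/-- The universal property of the model: extension of bifunctors. -/
theorem exists_extension_boxModel [HasColimitsOfSize.{v, v} E]
    (ho : ∀ i, IsCompactProjective k (o i)) (hS : GeneratesUnderColimits (.ofObj o))
    (hF : IsBicocontinuous k F) :
    ∃ G : BilinearPresheaf k o ⥤ E, IsCocontinuous k G ∧
      Nonempty (restrict (boxModel k o) G ≅ F) := by
  obtain ⟨G, ⟨adj⟩⟩ := (isRightAdjoint_boxNerve (o := o) hF).exists_leftAdjoint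
  have h1 : G.Additive := adj.left_adjoint_additive
  have h2 : G.Linear k := linear_leftAdjoint adj
  have h3 : PreservesColimitsOfSize.{v, v} G := adj.leftAdjoint_preservesColimits
  have hG : IsCocontinuous k G := ⟨h1, h2, h3⟩
  have hB := isBicocontinuous_boxModel ho
  let θ : restrict (boxModel k o) G ⟶ F :=
    { app := fun x =>
        { app := fun y => (adj.homEquiv _ _).symm (boxNerveUnit hF x y)
          naturality := fun y y' g => by
            dsimp
            rw [← adj.homEquiv_naturality_left_symm, ← adj.homEquiv_naturality_right_symm]
            refine congrArg _ (ObjectProperty.hom_ext _ (NatTrans.ext (funext fun p =>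
              ModuleCat.hom_ext (TensorProduct.ext' fun a b => ?_))))
            change (F.map a).app _ ≫ (F.obj _).map (b ≫ g) =
              ((F.map a).app _ ≫ (F.obj _).map b) ≫ (F.obj _).map g
            simp }
      naturality := fun x x' f => by
        ext y
        dsimp
        rw [← adj.homEquiv_naturality_left_symm, ← adj.homEquiv_naturality_right_symm]
        refine congrArg _ (ObjectProperty.hom_ext _ (NatTrans.ext (funext fun p =>
          ModuleCat.hom_ext (TensorProduct.ext' fun a b => ?_))))
        change (F.map (a ≫ f)).app _ ≫ (F.obj _).map b =
          ((F.map a).app _ ≫ (F.obj _).map b) ≫ (F.map f).app _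
        simp }
  -- At two generators, composition with `θ` is the Yoneda bijection followed by the adjunction
  -- bijection. Cocontinuity of both bifunctors then frees the first variable, and after it the
  -- second.
  have hθ (i j : ι) : IsIso ((θ.app (o i)).app (o j)) := by
    refine isIso_of_coyoneda_map_bijective _ fun e => ?_
    have : (fun h => (θ.app (o i)).app (o j) ≫ h) = (adj.homEquiv _ e).symm ∘
        (boxGenEquiv ⟨i, j⟩ ((boxNerve o hF).obj e)).symm := by
      funext h
      refine ((adj.homEquiv_naturality_right_symm _ _).symm.trans
        (congrArg _ ((LinearEquiv.eq_symm_apply _).2 ?_)))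
      change ((F.map (𝟙 _)).app _ ≫ (F.obj _).map (𝟙 _)) ≫ h = h
      simp
    rw [this]
    exact (adj.homEquiv _ e).symm.bijective.comp (LinearEquiv.bijective _)
  have hθ' (x : C) (j : ι) : IsIso ((θ.app x).app (o j)) := by
    have := (hB.left (o j)).comp hG |>.preservesColimits
    have := (hF.left (o j)).preservesColimits
    exact hS.isIso_app (F := (boxModel k o).flip.obj (o j) ⋙ G) (G := F.flip.obj (o j))
      { app := fun x => (θ.app x).app (o j)
        naturality := fun x x' f => congrArg (fun t => t.app (o j)) (θ.naturality f) }
      (by rintro _ ⟨i⟩; exact hθ i j) x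
  have hθ'' (x y : C) : IsIso ((θ.app x).app y) := by
    have := (hB.right x).comp hG |>.preservesColimits
    have := (hF.right x).preservesColimits
    exact hS.isIso_app (F := (boxModel k o).obj x ⋙ G) (G := F.obj x) (θ.app x)
      (by rintro _ ⟨j⟩; exact hθ' x j) y
  have (x : C) : IsIso (θ.app x) := (NatTrans.isIso_iff_isIso_app _).2 (hθ'' x)
  have : IsIso θ := (NatTrans.isIso_iff_isIso_app _).2 this
  exact ⟨G, hG, ⟨asIso θ⟩⟩

end Model

/-- A Deligne-Kelly tensor product of a category with enough compact projectives with itself. -/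
theorem isDeligneKelly_boxModel {k : Type v} [Field k] {C : Type (v + 1)} [Category.{v} C]
    [Preadditive C] [Linear k C] {ι : Type v} {o : ι → C} (ho : ∀ i, IsCompactProjective k (o i))
    (hS : GeneratesUnderColimits (.ofObj o)) : IsDeligneKelly k (boxModel k o) where
  bicocontinuous := isBicocontinuous_boxModel ho
  exists_extension {E} _ _ _ _ _ hF :=
    haveI := hasColimits_of_isLocallyPresentable E
    exists_extension_boxModel ho hS hF
  bijective_restrictIso _ _ hG hG' := (isBoxDense_boxModel ho).bijective_restrictIso hG hG'

/-! ### Density under exchange of variables and under equivalences. -/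

section Transport

variable {k : Type v} [Field k] {C : Type u} [Category.{v} C] [Preadditive C] [Linear k C]
  {P : Type u₁} [Category.{v} P] [Preadditive P] [Linear k P]
  {P' : Type u₂} [Category.{v} P'] [Preadditive P'] [Linear k P']
  {S : ObjectProperty C} {B : C ⥤ C ⥤ P}

theorem IsBicocontinuous.flip (hB : IsBicocontinuous k B) : IsBicocontinuous k B.flip :=
  ⟨hB.right, hB.left⟩

theorem IsBoxDense.flip (hB : IsBoxDense k S B) : IsBoxDense k S B.flip where
  bicocontinuous := hB.bicocontinuous.flip
  isCompactProjective hc hz := hB.isCompactProjective hz hc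
  bijective {c z} hc hz x y := by
    have : boxTensor hB.bicocontinuous.flip c x z y =
        boxTensor hB.bicocontinuous z y c x ∘ₗ (TensorProduct.comm k _ _).toLinearMap :=
      TensorProduct.ext' fun f g => ((B.map g).naturality f)
    rw [this]
    exact (hB.bijective hz hc y x).comp (LinearEquiv.bijective _)
  generates := hB.generates.mono (by
    rintro _ ⟨c, z, hc, hz⟩
    exact boxObjects.mk (B := B.flip) z c hz hc)

/-- Density is transported along equivalences. -/
theorem IsBoxDense.of_equivalence (hB : IsBoxDense k S B) (e : P ≌ P')
    (he : IsCocontinuous k e.functor) {B' : C ⥤ C ⥤ P'} (hB' : IsBicocontinuous k B')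
    (β : restrict B e.functor ≅ B') : IsBoxDense k S B' where
  bicocontinuous := hB'
  isCompactProjective {c z} hc hz := by
    obtain ⟨_, _, _⟩ := he
    exact ((hB.isCompactProjective hc hz).map e.toAdjunction).of_iso ((β.app c).app z)
  bijective {c z} hc hz x y := by
    obtain ⟨_, _, _⟩ := he
    have : boxTensor hB' c x z y =
        (Linear.homCongr k ((β.app c).app z) ((β.app x).app y)).toLinearMap ∘ₗ
          e.functor.mapLinearMap k ∘ₗ boxTensor hB.bicocontinuous c x z y := by
      refine TensorProduct.ext' fun f g => ?_
      have h1 := congrArg (fun t => t.app z) (β.hom.naturality f)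
      have h2 := (β.hom.app x).naturality g
      dsimp at h1 h2
      have h3 := ((β.app c).app z).inv_hom_id
      dsimp at h3
      simp [Linear.homCongr, h2, reassoc_of% h1, reassoc_of% h3]
    rw [this, LinearMap.coe_comp, LinearMap.coe_comp, LinearEquiv.coe_coe]
    exact (LinearEquiv.bijective _).comp (Function.Bijective.comp
      ⟨e.functor.map_injective, e.functor.map_surjective⟩ (hB.bijective hc hz x y))
  generates := by
    have := he.preservesColimits
    refine generatesUnderColimits_of_forall fun p =>
      .of_isoClosure (e.counitIso.app p) (hB.generates.map_closure e.functor ?_ (e.inverse.obj p))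
    rintro _ ⟨c, z, hc, hz⟩
    exact .of_isoClosure ((β.app c).app z).symm (.of_mem _ (.mk c z hc hz))

end Transport

/-! ### Existence of the product, and density in every product. -/

section DeligneKelly

variable {k : Type v} [Field k] {C : Type (v + 1)} [Category.{v} C] [Preadditive C] [Linear k C]

theorem isCocontinuous_id (P : Type u) [Category.{v} P] [Preadditive P] [Linear k P] :
    IsCocontinuous k (𝟭 P) := ⟨inferInstance, inferInstance, inferInstance⟩

/-- Two Deligne-Kelly tensor products are equivalent. -/
theorem IsDeligneKelly.exists_equivalence {P P' : Type (v + 1)} [Category.{v} P] [Category.{v} P']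
    [Preadditive P] [Linear k P] [Preadditive P'] [Linear k P'] [IsLocallyPresentable.{v} P]
    [IsLocallyPresentable.{v} P'] {B : C ⥤ C ⥤ P} {B' : C ⥤ C ⥤ P'} (hB : IsDeligneKelly k B)
    (hB' : IsDeligneKelly k B') :
    ∃ e : P ≌ P', IsCocontinuous k e.functor ∧ Nonempty (restrict B e.functor ≅ B') := by
  obtain ⟨G, hG, ⟨α⟩⟩ := hB.exists_extension B' hB'.bicocontinuous
  obtain ⟨G', hG', ⟨α'⟩⟩ := hB'.exists_extension B hB.bicocontinuous
  -- Both composites restrict to ⊠, so the universal property lifts these isomorphisms to a unit and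
  -- a counit; no triangle identity is needed for an equivalence.
  obtain ⟨η, -⟩ := (hB.bijective_restrictIso (𝟭 P) (G ⋙ G') (isCocontinuous_id P)
    (hG.comp hG')).2 (α'.symm ≪≫ Functor.isoWhiskerRight α.symm
      ((Functor.whiskeringRight C P' P).obj G'))
  obtain ⟨ε, -⟩ := (hB'.bijective_restrictIso (G' ⋙ G) (𝟭 P')
    (hG'.comp hG) (isCocontinuous_id P')).2 (Functor.isoWhiskerRight α'
      ((Functor.whiskeringRight C P P').obj G) ≪≫ α)
  exact ⟨CategoryTheory.Equivalence.mk G G' η ε, hG, ⟨α⟩⟩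

theorem HasEnoughCompactProjectives.exists_family (hC : HasEnoughCompactProjectives k C) :
    ∃ (ι : Type v) (o : ι → C), (∀ i, IsCompactProjective k (o i)) ∧
      GeneratesUnderColimits (.ofObj o) := by
  obtain ⟨S, _, hS, hS'⟩ := hC.exists_generators
  obtain ⟨Q, _, hQ, hQ'⟩ := ObjectProperty.EssentiallySmall.exists_small_le.{v} S
  refine ⟨Shrink.{v} (Subtype Q), fun i => ((equivShrink _).symm i).1,
    fun i => hS _ (hQ _ ((equivShrink _).symm i).2), hS'.of_closure fun c hc => ?_⟩
  obtain ⟨c', hc', ⟨e⟩⟩ := hQ' c hc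
  refine .of_isoClosure e.symm (.of_mem _ ?_)
  simpa using ObjectProperty.ofObj_apply
    (fun i : Shrink.{v} (Subtype Q) => ((equivShrink _).symm i).1) (equivShrink _ ⟨c', hc'⟩)

theorem HasEnoughCompactProjectives.nonempty_deligneKellyProduct
    (hC : HasEnoughCompactProjectives k C) : Nonempty (DeligneKellyProduct k C C) := by
  obtain ⟨ι, o, ho, hS⟩ := hC.exists_family
  exact ⟨{ obj := BilinearPresheaf k o, box := boxModel k o,
           isDeligneKelly := isDeligneKelly_boxModel ho hS }⟩

/-- One variable at a time: as ⊠ is cocontinuous in each variable, every c ⊠ z lies in the closure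
of the objects formed from `S'`. -/
theorem IsBoxDense.mono_generates {P : Type u₁} [Category.{v} P] [Preadditive P] [Linear k P]
    {S S' : ObjectProperty C} {B : C ⥤ C ⥤ P} (hB : IsBicocontinuous k B)
    (hS' : GeneratesUnderColimits S') (h : GeneratesUnderColimits (boxObjects S B)) :
    GeneratesUnderColimits (boxObjects S' B) := by
  refine h.of_closure ?_
  rintro _ ⟨c, z, -, -⟩
  have := (hB.left z).preservesColimits
  refine hS'.map_closure (B.flip.obj z) (fun c hc => ?_) c
  have := (hB.right c).preservesColimits
  exact hS'.map_closure (B.obj c) (fun z hz => .of_mem _ (.mk c z hc hz)) z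

/-- In every Deligne-Kelly tensor product, the objects `c ⊠ z` with `c` and `z` compact-projective
are compact-projective generators. -/
theorem DeligneKellyProduct.isBoxDense (P : DeligneKellyProduct k C C)
    (hC : HasEnoughCompactProjectives k C) : IsBoxDense k (IsCompactProjective k) P.box := by
  -- The model uses a small family, so the two given objects are adjoined to the generators, and the
  -- enlarged model is compared with `P`.
  have key (c z : C) (hc : IsCompactProjective k c) (hz : IsCompactProjective k z) :
      ∃ S : ObjectProperty C, S c ∧ S z ∧ S ≤ IsCompactProjective k ∧ IsBoxDense k S P.box := by
    obtain ⟨ι, o, ho, hS⟩ := hC.exists_family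
    let o' : ι ⊕ PUnit.{v + 1} ⊕ PUnit.{v + 1} → C := Sum.elim o (Sum.elim (fun _ => c) fun _ => z)
    have ho' : ∀ i, IsCompactProjective k (o' i) := by
      rintro (i | i | i)
      exacts [ho i, hc, hz]
    have hS' : GeneratesUnderColimits (.ofObj o') := hS.mono (by
      rintro _ ⟨i⟩
      exact ObjectProperty.ofObj_apply o' (.inl i))
    obtain ⟨e, he, ⟨β⟩⟩ := (isDeligneKelly_boxModel ho' hS').exists_equivalence P.isDeligneKelly
    refine ⟨.ofObj o', ObjectProperty.ofObj_apply o' (.inr (.inl ⟨⟩)),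
      ObjectProperty.ofObj_apply o' (.inr (.inr ⟨⟩)), ?_,
      (isBoxDense_boxModel ho').of_equivalence e he P.isDeligneKelly.bicocontinuous β⟩
    rintro _ ⟨i⟩
    exact ho' i
  refine ⟨P.isDeligneKelly.bicocontinuous, fun hc hz => ?_, fun hc hz => ?_, ?_⟩
  · obtain ⟨S, hc, hz, -, h⟩ := key _ _ hc hz
    exact h.isCompactProjective hc hz
  · obtain ⟨S, hc, hz, -, h⟩ := key _ _ hc hz
    exact h.bijective hc hz
  · obtain ⟨ι, o, ho, hS⟩ := hC.exists_family
    obtain ⟨e, he, ⟨β⟩⟩ := (isDeligneKelly_boxModel ho hS).exists_equivalence P.isDeligneKelly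
    refine ((isBoxDense_boxModel ho).of_equivalence e he
      P.isDeligneKelly.bicocontinuous β).generates.mono ?_
    rintro _ ⟨c, z, ⟨i⟩, ⟨j⟩⟩
    exact .mk _ _ (ho i) (ho j)

end DeligneKelly

/-! ### Invertibility of mates. -/

section Mates

variable {C : Type u} [Category.{v} C] {P : Type u₁} [Category.{v} P]

/-- A mate of an isomorphism `Φ ⋙ T ≅ T ⋙ φ` is invertible if the conjugate mate is. -/
theorem isIso_mate {T : P ⥤ C} {R : C ⥤ P} (adj : T ⊣ R) {Φ Φ' : P ⥤ P} (adjΦ : Φ' ⊣ Φ)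
    {φ φ' : C ⥤ C} (adjφ : φ' ⊣ φ) (σ : Φ ⋙ T ≅ T ⋙ φ)
    (h : ∀ p, IsIso (φ'.map (T.map (adjΦ.unit.app p)) ≫ φ'.map (σ.hom.app (Φ'.obj p)) ≫
      adjφ.counit.app (T.obj (Φ'.obj p)))) (m : C) :
    IsIso (adj.homEquiv _ _ (σ.hom.app (R.obj m) ≫ φ.map (adj.counit.app m))) := by
  rw [isIso_iff_yoneda_map_bijective]
  intro p
  have := h p
  -- By Yoneda: composition with the mate is the chain Hom(p, ΦRm) ≅ Hom(Φ'p, Rm) ≅ Hom(TΦ'p, m) ≅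
  -- Hom(φ'Tp, m) ≅ Hom(Tp, φm) ≅ Hom(p, Rφm), whose middle step is precomposition with the map
  -- assumed invertible.
  have key : (fun f : p ⟶ Φ.obj (R.obj m) =>
      f ≫ adj.homEquiv _ _ (σ.hom.app (R.obj m) ≫ φ.map (adj.counit.app m))) =
      adj.homEquiv p _ ∘ adjφ.homEquiv _ _ ∘
        (asIso (φ'.map (T.map (adjΦ.unit.app p)) ≫ φ'.map (σ.hom.app (Φ'.obj p)) ≫
          adjφ.counit.app (T.obj (Φ'.obj p)))).homFromEquiv.symm ∘
        (adj.homEquiv _ _).symm ∘ (adjΦ.homEquiv p _).symm := by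
    funext f
    obtain ⟨g, rfl⟩ := (adjΦ.homEquiv p _).surjective f
    dsimp only [Function.comp]
    rw [Equiv.symm_apply_apply, ← adj.homEquiv_naturality_left]
    refine congrArg _ ?_
    rw [← Equiv.symm_apply_eq]
    have hσ := σ.hom.naturality g
    dsimp at hσ
    have hε := adjφ.counit.naturality (T.map g)
    dsimp at hε
    simp only [Adjunction.homEquiv_counit, Adjunction.homEquiv_unit, Iso.homFromEquiv,
      Equiv.coe_fn_symm_mk, asIso_hom, Functor.map_comp, Category.assoc,
      Adjunction.counit_naturality]
    rw [← φ'.map_comp_assoc (T.map (Φ.map g)), hσ, φ'.map_comp_assoc, reassoc_of% hε]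
  rw [key]
  exact (Equiv.bijective _).comp ((Equiv.bijective _).comp ((Equiv.bijective _).comp
    ((Equiv.bijective _).comp (Equiv.bijective _))))

end Mates

/-! ### Pointwise colimits of cocontinuous functors. -/

section ColimitOfFunctors

variable {C : Type u} [Category.{v} C] {E : Type u₁} [Category.{v} E]

/-- Colimits commute with colimits: the pointwise colimit is `H.flip` followed by `colim`, both
cocontinuous. -/
theorem preservesColimits_of_isColimit [HasColimitsOfSize.{v, v} E] {J : Type v} [SmallCategory J]
    {H : J ⥤ C ⥤ E} {t : Cocone H} (ht : ∀ c, IsColimit (((evaluation C E).obj c).mapCocone t))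
    (h : ∀ j, PreservesColimitsOfSize.{v, v} (H.obj j)) :
    PreservesColimitsOfSize.{v, v} t.pt := by
  have : PreservesColimitsOfSize.{v, v} H.flip := ⟨fun {K _} => ⟨fun {F} => ⟨fun {s} hs =>
    ⟨evaluationJointlyReflectsColimits _ fun j => isColimitOfPreserves (H.obj j) hs⟩⟩⟩⟩
  let e : H.flip ⋙ colim ≅ t.pt := NatIso.ofComponents
    (fun c => (colimit.isColimit (H.flip.obj c)).coconePointUniqueUpToIso (ht c))
    (fun {c c'} f => colimit.hom_ext fun j => by
      have h1 := (colimit.isColimit (H.flip.obj c)).comp_coconePointUniqueUpToIso_hom (ht c) j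
      have h2 := (colimit.isColimit (H.flip.obj c')).comp_coconePointUniqueUpToIso_hom (ht c') j
      dsimp at h1 h2 ⊢
      rw [reassoc_of% h1, ι_colimMap_assoc, h2]
      simp)
  exact preservesColimits_of_natIso e

end ColimitOfFunctors

/-! ### Adjunctions between actions on C ⊠ C. -/

section BoxAction

variable {k : Type v} [Field k] {C : Type u} [Category.{v} C] [Preadditive C] [Linear k C]
  {P : Type u₁} [Category.{v} P] [Preadditive P] [Linear k P] {S : ObjectProperty C}
  {B : C ⥤ C ⥤ P}

/-- Adjunctions in the second variable extend to `C ⊠ C`. -/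
theorem IsBoxDense.exists_adjunction (hB : IsBoxDense k S B) {φ φ' : C ⥤ C} (adj : φ' ⊣ φ)
    {Φ Φ' : P ⥤ P} (hΦ : IsCocontinuous k Φ) (hΦ' : IsCocontinuous k Φ')
    (a : restrict B Φ ≅ B ⋙ (Functor.whiskeringLeft C C P).obj φ)
    (a' : restrict B Φ' ≅ B ⋙ (Functor.whiskeringLeft C C P).obj φ') :
    ∃ adjΦ : Φ' ⊣ Φ, ∀ x y, adjΦ.unit.app ((B.obj x).obj y) =
      (B.obj x).map (adj.unit.app y) ≫ (a.inv.app x).app (φ'.obj y) ≫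
        Φ.map ((a'.inv.app x).app y) := by
  have hΦΦ' := hΦ.comp hΦ'
  have hΦ'Φ := hΦ'.comp hΦ
  obtain ⟨_, _, _⟩ := id hΦ
  obtain ⟨_, _, _⟩ := id hΦ'
  -- On x ⊠ y the unit and counit are those of `adj` in the second variable, transported through `a`
  -- and `a'`; density extends them and reduces the triangle identities to those of `adj`.
  obtain ⟨η, hη⟩ := hB.exists_lift (isCocontinuous_id P) (G' := Φ' ⋙ Φ)
    { app := fun x =>
        { app := fun y => (B.obj x).map (adj.unit.app y) ≫ (a.inv.app x).app (φ'.obj y) ≫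
            Φ.map ((a'.inv.app x).app y)
          naturality := fun y y' g => by
            have h1 := (a.inv.app x).naturality (φ'.map g)
            have h2 := (a'.inv.app x).naturality g
            have h3 := adj.unit.naturality g
            dsimp at h1 h2 h3 ⊢
            rw [← Functor.map_comp_assoc, h3, Functor.map_comp_assoc, reassoc_of% h1,
              ← Φ.map_comp, h2]
            simp }
      naturality := fun x x' f => by
        ext y
        have h1 := congrArg (fun t => t.app (φ'.obj y)) (a.inv.naturality f)
        have h2 := congrArg (fun t => t.app y) (a'.inv.naturality f)
        dsimp at h1 h2 ⊢
        rw [← NatTrans.naturality_assoc, reassoc_of% h1, ← Φ.map_comp, h2]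
        simp }
  obtain ⟨ε, hε⟩ := hB.exists_lift (G := Φ ⋙ Φ') hΦΦ' (G' := 𝟭 P)
    { app := fun x =>
        { app := fun y => Φ'.map ((a.hom.app x).app y) ≫ (a'.hom.app x).app (φ.obj y) ≫
            (B.obj x).map (adj.counit.app y)
          naturality := fun y y' g => by
            have h1 := (a.hom.app x).naturality g
            have h2 := (a'.hom.app x).naturality (φ.map g)
            have h3 := adj.counit.naturality g
            dsimp at h1 h2 h3 ⊢
            rw [← Φ'.map_comp_assoc, h1, Φ'.map_comp_assoc, reassoc_of% h2,
              ← Functor.map_comp, h3]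
            simp }
      naturality := fun x x' f => by
        ext y
        have h1 := congrArg (fun t => t.app y) (a.hom.naturality f)
        have h2 := congrArg (fun t => t.app (φ.obj y)) (a'.hom.naturality f)
        dsimp at h1 h2 ⊢
        rw [← Φ'.map_comp_assoc, h1, Φ'.map_comp_assoc, reassoc_of% h2]
        simp }
  dsimp at hη hε
  refine ⟨Adjunction.mkOfUnitCounit ⟨η, ε, ?_, ?_⟩, fun x y => hη x y⟩
  · refine hB.natTrans_ext fun x y => ?_
    have h1 := ε.naturality ((a'.hom.app x).app y)
    have h2 := (a'.hom.app x).naturality (adj.unit.app y)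
    have h3 := adj.left_triangle_components y
    dsimp at h1 h2 h3 ⊢
    have h4 : (((B.obj x).map (adj.unit.app y) ≫ (a.inv.app x).app (φ'.obj y) ≫
        Φ.map ((a'.inv.app x).app y)) ≫ Φ.map ((a'.hom.app x).app y)) ≫
          (a.hom.app x).app (φ'.obj y) = (B.obj x).map (adj.unit.app y) := by
      have h5 := congrArg (fun t => (t.app x).app y) a'.inv_hom_id
      have h6 := congrArg (fun t => (t.app x).app (φ'.obj y)) a.inv_hom_id
      dsimp at h5 h6
      rw [Category.assoc, Category.assoc, Category.assoc, ← Φ.map_comp_assoc, h5, Φ.map_id,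
        Category.id_comp, h6]
      exact Category.comp_id _
    rw [Category.id_comp, hη, ← cancel_mono ((a'.hom.app x).app y), Category.assoc, ← h1, hε,
      ← Φ'.map_comp_assoc, ← Φ'.map_comp_assoc, h4, reassoc_of% h2, ← Functor.map_comp, h3,
      CategoryTheory.Functor.map_id]
    exact (Category.comp_id _).trans (Category.id_comp _).symm
  · refine NatTrans.ext (funext fun p => ?_)
    suffices Functor.whiskerLeft Φ η ≫ Functor.whiskerRight ε Φ = 𝟙 Φ by
      simpa using congrArg (fun t => t.app p) this
    refine hB.natTrans_ext fun x y => ?_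
    have h1 := η.naturality ((a.inv.app x).app y)
    have h2 := (a.inv.app x).naturality (adj.counit.app y)
    have h3 := adj.right_triangle_components y
    have h5 := congrArg (fun t => (t.app x).app (φ.obj y)) a'.inv_hom_id
    have h6 := congrArg (fun t => (t.app x).app y) a.inv_hom_id
    dsimp at h1 h2 h3 h5 h6 ⊢
    have h4 : Φ.map ((a'.inv.app x).app (φ.obj y)) ≫ Φ.map (Φ'.map ((a.inv.app x).app y)) ≫
        Φ.map (Φ'.map ((a.hom.app x).app y) ≫ (a'.hom.app x).app (φ.obj y) ≫
          (B.obj x).map (adj.counit.app y)) = Φ.map ((B.obj x).map (adj.counit.app y)) := by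
      rw [← Φ.map_comp, ← Φ.map_comp, ← Φ'.map_comp_assoc, h6, Φ'.map_id, Category.id_comp,
        reassoc_of% h5]
    rw [← cancel_epi ((a.inv.app x).app y), reassoc_of% h1, hη, hε, Category.assoc,
      Category.assoc, h4, ← h2, ← Functor.map_comp_assoc, h3, CategoryTheory.Functor.map_id]
    exact (Category.id_comp _).trans (Category.comp_id _).symm

end BoxAction

/-- The data relating an action on the second variable of `B = ⊠`, a functor `T` with
`T (x ⊠ y) ≅ M (x, y)`, and the corresponding action `Ψ` on the target. -/
structure BoxAction (k : Type v) [Field k] {C : Type u} [Category.{v} C] [Preadditive C]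
    [Linear k C] {P : Type u₁} [Category.{v} P] [Preadditive P] [Linear k P] (B : C ⥤ C ⥤ P)
    (T : P ⥤ C) where
  /-- The bifunctor induced by `T`. -/
  M : C ⥤ C ⥤ C
  /-- The action on the target. -/
  Ψ : C ⥤ C ⥤ C
  /-- The action on the source. -/
  act : C → P ⥤ P
  τ : restrict B T ≅ M
  actIso (c : C) : restrict B (act c) ≅ B ⋙ (Functor.whiskeringLeft C C P).obj (Ψ.obj c)
  assoc (c x y : C) : (M.obj x).obj ((Ψ.obj c).obj y) ≅ (Ψ.obj c).obj ((M.obj x).obj y)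
  assoc_naturality {c c' : C} (f : c ⟶ c') (x y : C) :
    (M.obj x).map ((Ψ.map f).app y) ≫ (assoc c' x y).hom =
      (assoc c x y).hom ≫ (Ψ.map f).app ((M.obj x).obj y)
  σ (c : C) : act c ⋙ T ≅ T ⋙ Ψ.obj c
  σ_app (c x y : C) : (σ c).hom.app ((B.obj x).obj y) =
    T.map (((actIso c).hom.app x).app y) ≫ (τ.hom.app x).app ((Ψ.obj c).obj y) ≫
      (assoc c x y).hom ≫ (Ψ.obj c).map ((τ.inv.app x).app y)
  isCocontinuous : IsCocontinuous k T
  isCocontinuous_act (c : C) : IsCocontinuous k (act c)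
  isBicocontinuous : IsBicocontinuous k Ψ

/-! ### The lax structure of a right adjoint, for both actions at once. -/

namespace BoxAction

variable {k : Type v} [Field k] {C : Type u} [Category.{v} C] [Preadditive C] [Linear k C]
  {P : Type u₁} [Category.{v} P] [Preadditive P] [Linear k P] {B : C ⥤ C ⥤ P} {T : P ⥤ C}
  (D : BoxAction k B T) {R : C ⥤ P} (adj : T ⊣ R)

/-- The lax module structure of a right adjoint. -/
def lax (c m : C) : (D.act c).obj (R.obj m) ⟶ R.obj ((D.Ψ.obj c).obj m) :=
  adj.homEquiv _ _ ((D.σ c).hom.app (R.obj m) ≫ (D.Ψ.obj c).map (adj.counit.app m))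

variable {S : ObjectProperty C} (hB : IsBoxDense k S B)

include hB

/-- The lax module structure is strong at `c` if `c` acts by a right adjoint, compatibly with
the associativity isomorphisms. -/
theorem isIso_lax_of_adjunction {c c' : C} (adjc : D.Ψ.obj c' ⊣ D.Ψ.obj c)
    (h : ∀ x y, IsIso ((D.Ψ.obj c').map ((D.M.obj x).map (adjc.unit.app y)) ≫
      (D.Ψ.obj c').map (D.assoc c x ((D.Ψ.obj c').obj y)).hom ≫
        adjc.counit.app ((D.M.obj x).obj ((D.Ψ.obj c').obj y)))) (m : C) :
    IsIso (D.lax adj c m) := by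
  obtain ⟨adjΦ, hunit⟩ := hB.exists_adjunction adjc (D.isCocontinuous_act c)
    (D.isCocontinuous_act c') (D.actIso c) (D.actIso c')
  refine isIso_mate adj adjΦ adjc (D.σ c) (fun p => ?_) m
  -- This is the conjugate mate. Both of its ends are cocontinuous, so it suffices to invert it at x
  -- ⊠ y, where it is the composite of `h` between isomorphisms.
  let κ : T ⋙ D.Ψ.obj c' ⟶ D.act c' ⋙ T :=
    Functor.whiskerRight (Functor.whiskerRight adjΦ.unit T) (D.Ψ.obj c') ≫
      Functor.whiskerRight (Functor.whiskerLeft (D.act c') (D.σ c).hom) (D.Ψ.obj c') ≫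
        Functor.whiskerLeft (D.act c' ⋙ T) adjc.counit
  have := (D.isCocontinuous.comp (D.isBicocontinuous.right c')).preservesColimits
  have := ((D.isCocontinuous_act c').comp D.isCocontinuous).preservesColimits
  refine hB.generates.isIso_app κ ?_ p
  rintro _ ⟨x, y, -, -⟩
  have h1 := (D.σ c).hom.naturality (((D.actIso c').inv.app x).app y)
  have h2 := adjc.counit.naturality (T.map (((D.actIso c').inv.app x).app y))
  have h3 := (D.τ.hom.app x).naturality (adjc.unit.app y)
  have h4 := congrArg (fun t => (t.app x).app ((D.Ψ.obj c').obj y)) (D.actIso c).inv_hom_id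
  have h5 := adjc.counit.naturality ((D.τ.inv.app x).app ((D.Ψ.obj c').obj y))
  dsimp at h1 h2 h3 h4 h5
  have h6 : κ.app ((B.obj x).obj y) = (D.Ψ.obj c').map ((D.τ.hom.app x).app y) ≫
      ((D.Ψ.obj c').map ((D.M.obj x).map (adjc.unit.app y)) ≫
        (D.Ψ.obj c').map (D.assoc c x ((D.Ψ.obj c').obj y)).hom ≫
          adjc.counit.app ((D.M.obj x).obj ((D.Ψ.obj c').obj y))) ≫
      (D.τ.inv.app x).app ((D.Ψ.obj c').obj y) ≫
        T.map (((D.actIso c').inv.app x).app y) := by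
    have h7 : T.map (adjΦ.unit.app ((B.obj x).obj y)) ≫
        (D.σ c).hom.app ((D.act c').obj ((B.obj x).obj y)) = (D.τ.hom.app x).app y ≫
          (D.M.obj x).map (adjc.unit.app y) ≫ (D.assoc c x ((D.Ψ.obj c').obj y)).hom ≫
          (D.Ψ.obj c).map ((D.τ.inv.app x).app ((D.Ψ.obj c').obj y)) ≫
          (D.Ψ.obj c).map (T.map (((D.actIso c').inv.app x).app y)) := by
      rw [hunit, T.map_comp, T.map_comp, Category.assoc, Category.assoc, h1, D.σ_app]
      have h8 : T.map (((D.actIso c).inv.app x).app ((D.Ψ.obj c').obj y)) ≫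
          T.map (((D.actIso c).hom.app x).app ((D.Ψ.obj c').obj y)) = 𝟙 _ :=
        (T.map_comp _ _).symm.trans ((congrArg T.map h4).trans (T.map_id _))
      simp only [Category.assoc]
      rw [reassoc_of% h8, reassoc_of% h3]
    dsimp [κ]
    rw [← Functor.map_comp_assoc, h7]
    simp only [Functor.map_comp, Category.assoc]
    rw [h2, reassoc_of% h5]
  rw [h6]
  have := h x y
  infer_instance

/-- The actions are given one object `c` at a time, through the universal property; density recovers
their functoriality in `c`, which is needed to speak of colimits in `c`. -/
theorem exists_actMap {c c' : C} (f : c ⟶ c') : ∃ φ : D.act c ⟶ D.act c', ∀ x y,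
    φ.app ((B.obj x).obj y) = ((D.actIso c).hom.app x).app y ≫
      (B.obj x).map ((D.Ψ.map f).app y) ≫ ((D.actIso c').inv.app x).app y := by
  have h := D.isCocontinuous_act c'
  obtain ⟨_, _, _⟩ := id h
  exact hB.exists_lift (D.isCocontinuous_act c) ((D.actIso c).hom ≫
    Functor.whiskerLeft B ((Functor.whiskeringLeft C C P).map (D.Ψ.map f)) ≫ (D.actIso c').inv)

/-- The action on the source of a morphism. -/
noncomputable def actMap {c c' : C} (f : c ⟶ c') : D.act c ⟶ D.act c' :=
  (D.exists_actMap hB f).choose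

theorem actMap_app {c c' : C} (f : c ⟶ c') (x y : C) :
    (D.actMap hB f).app ((B.obj x).obj y) = ((D.actIso c).hom.app x).app y ≫
      (B.obj x).map ((D.Ψ.map f).app y) ≫ ((D.actIso c').inv.app x).app y :=
  (D.exists_actMap hB f).choose_spec x y

/-- At x ⊠ y this is naturality of the associativity isomorphism in the acting object. -/
theorem actMap_σ {c c' : C} (f : c ⟶ c') : Functor.whiskerRight (D.actMap hB f) T ≫
    (D.σ c').hom = (D.σ c).hom ≫ Functor.whiskerLeft T (D.Ψ.map f) := by
  have := ((D.isCocontinuous_act c).comp D.isCocontinuous).preservesColimits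
  refine hB.natTrans_ext fun x y => ?_
  have h1 := congrArg (fun t => (t.app x).app y) (D.actIso c').inv_hom_id
  have h2 := (D.τ.hom.app x).naturality ((D.Ψ.map f).app y)
  have h3 := (D.Ψ.map f).naturality ((D.τ.inv.app x).app y)
  have h4 := D.assoc_naturality f x y
  dsimp at h1 h2 h3 ⊢
  rw [D.σ_app, D.σ_app, actMap_app]
  simp only [T.map_comp, Category.assoc]
  have h5 : T.map (((D.actIso c').inv.app x).app y) ≫
      T.map (((D.actIso c').hom.app x).app y) = 𝟙 _ :=
    (T.map_comp _ _).symm.trans ((congrArg T.map h1).trans (T.map_id _))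
  rw [h3, ← reassoc_of% h4, ← reassoc_of% h2, reassoc_of% h5]

theorem lax_naturality {c c' : C} (f : c ⟶ c') (m : C) :
    (D.actMap hB f).app (R.obj m) ≫ D.lax adj c' m =
      D.lax adj c m ≫ R.map ((D.Ψ.map f).app m) := by
  have h1 := congrArg (fun t => t.app (R.obj m)) (D.actMap_σ hB f)
  have h2 := (D.Ψ.map f).naturality (adj.counit.app m)
  dsimp [lax] at h1 h2 ⊢
  rw [← adj.homEquiv_naturality_left, ← adj.homEquiv_naturality_right, reassoc_of% h1,
    Category.assoc, h2]

/-- The action on the source as a bifunctor. -/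
noncomputable def actFunctor : C ⥤ P ⥤ P where
  obj := D.act
  map f := D.actMap hB f
  map_id c := by
    have := (D.isCocontinuous_act c).preservesColimits
    refine hB.natTrans_ext fun x y => ?_
    have h := congrArg (fun t => (t.app x).app y) (D.actIso c).hom_inv_id
    dsimp at h
    rw [actMap_app, D.Ψ.map_id, NatTrans.id_app, CategoryTheory.Functor.map_id]
    exact (congrArg _ (Category.id_comp _)).trans h
  map_comp {c c' c''} f g := by
    have := (D.isCocontinuous_act c).preservesColimits
    refine hB.natTrans_ext fun x y => ?_
    have h := congrArg (fun t => (t.app x).app y) (D.actIso c').inv_hom_id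
    dsimp at h
    rw [NatTrans.comp_app, actMap_app, actMap_app, actMap_app]
    simp [reassoc_of% h]

/-- For p = x ⊠ y the functor is c ↦ x ⊠ Ψ_c(y), cocontinuous in c; a general p is reached by
colimits, which the action of each c preserves. -/
theorem preservesColimits_actFunctor_flip [HasColimitsOfSize.{v, v} P] (p : P) :
    PreservesColimitsOfSize.{v, v} ((D.actFunctor hB).flip.obj p) := by
  refine hB.generates.induction
    (Q := fun p => PreservesColimitsOfSize.{v, v} ((D.actFunctor hB).flip.obj p)) ?_ ?_ p
  · rintro _ ⟨x, y, -, -⟩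
    have := ((D.isBicocontinuous.left y).comp (hB.bicocontinuous.right x)).preservesColimits
    refine preservesColimits_of_natIso (F := D.Ψ.flip.obj y ⋙ B.obj x)
      (NatIso.ofComponents (fun c => ((D.actIso c).symm.app x).app y) fun {c c'} f => ?_)
    refine Eq.trans ?_ (congrArg (fun t => ((D.actIso c).inv.app x).app y ≫ t)
      (D.actMap_app hB f x y)).symm
    have h := congrArg (fun t => (t.app x).app y) (D.actIso c).inv_hom_id
    dsimp at h ⊢
    rw [reassoc_of% h]
    rfl
  · intro J _ F s hs ih
    refine preservesColimits_of_isColimit (t := (D.actFunctor hB).flip.mapCocone s) (fun c => ?_) ih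
    have := (D.isCocontinuous_act c).preservesColimits
    exact isColimitOfPreserves (D.act c) hs

/-- The class of objects at which the lax structure is strong is closed under colimits. -/
theorem isIso_lax_of_generates [HasColimitsOfSize.{v, v} P] [PreservesColimitsOfSize.{v, v} R]
    {S' : ObjectProperty C} (hS' : GeneratesUnderColimits S')
    (h : ∀ c m, S' c → IsIso (D.lax adj c m)) (c m : C) : IsIso (D.lax adj c m) := by
  have := D.preservesColimits_actFunctor_flip hB (R.obj m)
  have := (D.isBicocontinuous.left m).preservesColimits
  -- The lax maps for varying `c` form a transformation of cocontinuous functors; cocontinuity of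
  -- the target uses that of `R`.
  let α : (D.actFunctor hB).flip.obj (R.obj m) ⟶ D.Ψ.flip.obj m ⋙ R :=
    { app := fun c => D.lax adj c m
      naturality := fun _ _ f => D.lax_naturality adj hB f m }
  exact hS'.isIso_app α (fun c hc => h c m hc) c

end BoxAction

/-! ### The left and right actions on C ⊠ C. -/

namespace DeligneKellyProduct

variable {k : Type v} [Field k] {C : Type (v + 1)} [Category.{v} C] [Preadditive C] [Linear k C]
  [MonoidalCategory C] [IsTensorCategory k C] (P : DeligneKellyProduct k C C)

/-- The right action of `C` on `C ⊠ C`. -/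
noncomputable def rightAction : BoxAction k P.box P.mul where
  M := curriedTensor C
  Ψ := (curriedTensor C).flip
  act := P.actRight
  τ := P.mulIso
  actIso := P.actRightIso
  assoc c x y := (α_ x y c).symm
  assoc_naturality f x y := by
    dsimp
    simp
  σ := P.mulActRightIso
  σ_app c x y := by
    have : IsLocallyPresentable.{v} C := IsTensorCategory.locallyPresentable k
    exact congrArg (fun e => (e.hom.app x).app y) (P.restrictIso_liftIso
      ((P.actRight_isCocontinuous c).comp P.mul_isCocontinuous)
      (P.mul_isCocontinuous.comp (isCocontinuous_tensorRight k c)) (P.mulActRightBoxIso c))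
  isCocontinuous := P.mul_isCocontinuous
  isCocontinuous_act := P.actRight_isCocontinuous
  isBicocontinuous := IsBicocontinuous.flip IsTensorCategory.bicocontinuous

/-- The left action of `C` on `C ⊠ C`, as an action on the second variable of the flipped
bifunctor `⊠`. -/
noncomputable def leftAction : BoxAction k P.box.flip P.mul where
  M := (curriedTensor C).flip
  Ψ := curriedTensor C
  act := P.actLeft
  τ := NatIso.ofComponents (fun y => NatIso.ofComponents (fun x => (P.mulIso.app x).app y)
    fun f => congrArg (fun t => t.app y) (P.mulIso.hom.naturality f)) fun f => by
      ext x
      exact (P.mulIso.hom.app x).naturality f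
  actIso c := NatIso.ofComponents (fun y => NatIso.ofComponents
    (fun x => ((P.actLeftIso c).app x).app y)
    fun f => congrArg (fun t => t.app y) ((P.actLeftIso c).hom.naturality f)) fun f => by
      ext x
      exact ((P.actLeftIso c).hom.app x).naturality f
  assoc c x y := α_ c y x
  assoc_naturality f x y := by
    dsimp
    simp
  σ := P.mulActLeftIso
  σ_app c x y := by
    have : IsLocallyPresentable.{v} C := IsTensorCategory.locallyPresentable k
    exact congrArg (fun e => (e.hom.app y).app x) (P.restrictIso_liftIso
      ((P.actLeft_isCocontinuous c).comp P.mul_isCocontinuous)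
      (P.mul_isCocontinuous.comp (isCocontinuous_tensorLeft k c)) (P.mulActLeftBoxIso c))
  isCocontinuous := P.mul_isCocontinuous
  isCocontinuous_act := P.actLeft_isCocontinuous
  isBicocontinuous := IsTensorCategory.bicocontinuous

end DeligneKellyProduct

/-! ### Duals: the mates are associators. -/

section Rigid

variable {C : Type u} [Category.{v} C] [MonoidalCategory C]

open ExactPairing

theorem tensorRightAdjunction_unit_app (Y Y' : C) [ExactPairing Y Y'] (y : C) :
    (tensorRightAdjunction Y Y').unit.app y =
      (ρ_ y).inv ≫ y ◁ η_ Y Y' ≫ (α_ y Y Y').inv := by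
  simp [tensorRightAdjunction, tensorRightHomEquiv]

theorem tensorRightAdjunction_counit_app (Y Y' : C) [ExactPairing Y Y'] (y : C) :
    (tensorRightAdjunction Y Y').counit.app y =
      (α_ y Y' Y).hom ≫ y ◁ ε_ Y Y' ≫ (ρ_ y).hom := by
  simp [tensorRightAdjunction, tensorRightHomEquiv]

theorem tensorLeftAdjunction_unit_app (Y Y' : C) [ExactPairing Y Y'] (y : C) :
    (tensorLeftAdjunction Y Y').unit.app y =
      (λ_ y).inv ≫ η_ Y Y' ▷ y ≫ (α_ Y Y' y).hom := by
  simp [tensorLeftAdjunction, tensorLeftHomEquiv]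

theorem tensorLeftAdjunction_counit_app (Y Y' : C) [ExactPairing Y Y'] (y : C) :
    (tensorLeftAdjunction Y Y').counit.app y =
      (α_ Y' Y y).inv ≫ ε_ Y Y' ▷ y ≫ (λ_ y).hom := by
  simp [tensorLeftAdjunction, tensorLeftHomEquiv]

/-- A zigzag identity cancels the duality maps. The left side is the composite required by
`BoxAction.isIso_lax_of_adjunction` for the right action. -/
theorem tensorRightAdjunction_mate (Y Y' : C) [ExactPairing Y Y'] (x y : C) :
    (x ◁ (tensorRightAdjunction Y Y').unit.app y) ▷ Y ≫ (α_ x (y ⊗ Y) Y').inv ▷ Y ≫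
      (tensorRightAdjunction Y Y').counit.app (x ⊗ y ⊗ Y) = (α_ x y Y).hom := by
  rw [tensorRightAdjunction_unit_app, tensorRightAdjunction_counit_app]
  calc
    _ = 𝟙 ((x ⊗ y) ⊗ Y) ⊗≫ (x ⊗ y) ◁ (η_ Y Y' ▷ Y ⊗≫ Y ◁ ε_ Y Y') ⊗≫
        𝟙 (x ⊗ y ⊗ Y) := by monoidal
    _ = _ := by rw [evaluation_coevaluation'']; monoidal

theorem tensorLeftAdjunction_mate (Y Y' : C) [ExactPairing Y Y'] (x y : C) :
    Y' ◁ ((tensorLeftAdjunction Y Y').unit.app y ▷ x) ≫ Y' ◁ (α_ Y (Y' ⊗ y) x).hom ≫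
      (tensorLeftAdjunction Y Y').counit.app ((Y' ⊗ y) ⊗ x) = (α_ Y' y x).inv := by
  rw [tensorLeftAdjunction_unit_app, tensorLeftAdjunction_counit_app]
  calc
    _ = 𝟙 (Y' ⊗ y ⊗ x) ⊗≫ (Y' ◁ η_ Y Y' ⊗≫ ε_ Y Y' ▷ Y') ▷ (y ⊗ x) ⊗≫
        𝟙 ((Y' ⊗ y) ⊗ x) := by monoidal
    _ = _ := by rw [coevaluation_evaluation'']; monoidal

end Rigid

/-- With *c a left dual of `c`, the functor c ⊗ - is left adjoint to the cocontinuous functor *c ⊗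
-. -/
theorem IsCompactProjective.tensor {k : Type v} [Field k] {C : Type (v + 1)} [Category.{v} C]
    [Preadditive C] [Linear k C] [MonoidalCategory C] [IsTensorCategory k C] {c z : C}
    (hc : IsDualizable c) (hz : IsCompactProjective k z) : IsCompactProjective k (c ⊗ z) := by
  obtain ⟨⟨_⟩, -⟩ := hc
  have h := DeligneKellyProduct.isCocontinuous_tensorLeft k c
  have := h.additive
  have := h.linear
  have := (DeligneKellyProduct.isCocontinuous_tensorLeft k
    (HasLeftDual.leftDual c)).preservesColimits
  exact hz.map (tensorLeftAdjunction (HasLeftDual.leftDual c) c)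

/-- Strength for the left action uses the right dual of `c`, and for the right action the left dual:
these provide left adjoints of c ⊗ - and of - ⊗ c. -/
theorem DeligneKellyProduct.hasStrongRightAdjoint {k : Type v} [Field k] {C : Type (v + 1)}
    [Category.{v} C] [Preadditive C] [Linear k C] [MonoidalCategory C] [IsTensorCategory k C]
    (hC : HasEnoughCompactProjectives k C) (P : DeligneKellyProduct k C C)
    {S : ObjectProperty C} (hS : GeneratesUnderColimits S)
    (h : ∀ c, S c → IsCompactProjective k c ∧ IsDualizable c) : P.HasStrongRightAdjoint := by
  have hP := P.isBoxDense hC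
  have := P.mul_isCocontinuous.additive
  have := P.mul_isCocontinuous.linear
  have := P.mul_isCocontinuous.preservesColimits
  have := hC.hasColimits
  have := hasColimits_of_isLocallyPresentable P.obj
  have := isLeftAdjoint_of_isLocallyPresentable P.mul
  have adj := Adjunction.ofIsLeftAdjoint P.mul
  have hR : PreservesColimitsOfSize.{v, v} (Functor.rightAdjoint P.mul) := by
    refine preservesColimits_rightAdjoint (k := k) adj
      (IsBoxDense.mono_generates hP.bicocontinuous hS hP.generates) ?_ ?_
    · rintro _ ⟨c, z, hc, hz⟩
      exact hP.isCompactProjective (h c hc).1 (h z hz).1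
    · rintro _ ⟨c, z, hc, hz⟩
      exact (IsCompactProjective.tensor (h c hc).2 (h z hz).1).of_iso
        ((P.mulIso.app c).app z).symm
  refine ⟨_, adj, hR, P.leftAction.isIso_lax_of_generates adj hP.flip hS fun c m hc => ?_,
    P.rightAction.isIso_lax_of_generates adj hP hS fun c m hc => ?_⟩
  · obtain ⟨-, -, ⟨_⟩⟩ := h c hc
    refine P.leftAction.isIso_lax_of_adjunction adj hP.flip
      (tensorLeftAdjunction c (HasRightDual.rightDual c)) (fun x y => ?_) m
    exact (tensorLeftAdjunction_mate c (HasRightDual.rightDual c) x y) ▸ Iso.isIso_inv _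
  · obtain ⟨-, ⟨_⟩, -⟩ := h c hc
    refine P.rightAction.isIso_lax_of_adjunction adj hP
      (tensorRightAdjunction (HasLeftDual.leftDual c) c) (fun x y => ?_) m
    exact (tensorRightAdjunction_mate (HasLeftDual.leftDual c) c x y) ▸ Iso.isIso_hom _

/-! ### Recognizing duals by representability. -/

section Dual

variable {C : Type u} [Category.{v} C] [MonoidalCategory C]

/-- An object is a left dual of `c` if it represents the functors `Hom(c ⊗ -, 𝟙 ⊗ d)`,
`x ↦ Hom(x, h ⊗ d)`, through a morphism `c ⊗ h ⟶ 𝟙`. -/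
theorem nonempty_hasLeftDual {c h : C} (ev : c ⊗ h ⟶ 𝟙_ C)
    (H : ∀ d x : C, Function.Bijective (fun f : x ⟶ h ⊗ d =>
      c ◁ f ≫ (α_ c h d).inv ≫ ev ▷ d)) : Nonempty (HasLeftDual c) := by
  -- The coevaluation is the preimage of c ⊗ 𝟙 ≅ 𝟙 ⊗ c, taking d = c and x = 𝟙; one triangle
  -- identity holds by this choice.
  obtain ⟨η, hη⟩ := (H c (𝟙_ C)).2 ((ρ_ c).hom ≫ (λ_ c).inv)
  have hη' : c ◁ η ⊗≫ ev ▷ c = ⊗𝟙.hom := by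
    convert! hη <;> simp [monoidalComp]
  exact ⟨{ leftDual := h, exact := {
    coevaluation' := η
    evaluation' := ev
    coevaluation_evaluation' := hη
    -- The other triangle identity follows from injectivity at d = 𝟙: after pairing with `c`, it
    -- reduces to the first.
    evaluation_coevaluation' := (H (𝟙_ C) (𝟙_ C ⊗ h)).1 (by
      calc
        _ = 𝟙 (c ⊗ 𝟙_ C ⊗ h) ⊗≫ c ◁ η ▷ h ⊗≫ ((c ⊗ h) ◁ ev ≫ ev ▷ 𝟙_ C) ⊗≫
          𝟙 (𝟙_ C ⊗ 𝟙_ C) := by monoidal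
        _ = 𝟙 (c ⊗ 𝟙_ C ⊗ h) ⊗≫ (c ◁ η ⊗≫ ev ▷ c) ▷ h ⊗≫ 𝟙_ C ◁ ev ⊗≫ 𝟙 (𝟙_ C ⊗ 𝟙_ C) := by
          rw [whisker_exchange]; monoidal
        _ = _ := by rw [hη']; monoidal) } }⟩

/-- An object is a right dual of `c` if it represents the functors `Hom(- ⊗ c, d ⊗ 𝟙)`,
`x ↦ Hom(x, d ⊗ h)`, through a morphism `h ⊗ c ⟶ 𝟙`. -/
theorem nonempty_hasRightDual {c h : C} (ev : h ⊗ c ⟶ 𝟙_ C)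
    (H : ∀ d x : C, Function.Bijective (fun f : x ⟶ d ⊗ h =>
      f ▷ c ≫ (α_ d h c).hom ≫ d ◁ ev)) : Nonempty (HasRightDual c) := by
  obtain ⟨η, hη⟩ := (H c (𝟙_ C)).2 ((λ_ c).hom ≫ (ρ_ c).inv)
  have hη' : η ▷ c ⊗≫ c ◁ ev = ⊗𝟙.hom := by
    convert! hη <;> simp [monoidalComp]
  exact ⟨{ rightDual := h, exact := {
    coevaluation' := η
    evaluation' := ev
    coevaluation_evaluation' := (H (𝟙_ C) (h ⊗ 𝟙_ C)).1 (by
      calc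
        _ = 𝟙 ((h ⊗ 𝟙_ C) ⊗ c) ⊗≫ h ◁ η ▷ c ⊗≫ (ev ▷ (h ⊗ c) ≫ 𝟙_ C ◁ ev) ⊗≫
          𝟙 (𝟙_ C ⊗ 𝟙_ C) := by monoidal
        _ = 𝟙 ((h ⊗ 𝟙_ C) ⊗ c) ⊗≫ h ◁ (η ▷ c ⊗≫ c ◁ ev) ⊗≫ ev ▷ 𝟙_ C ⊗≫
            𝟙 (𝟙_ C ⊗ 𝟙_ C) := by
          rw [← whisker_exchange]; monoidal
        _ = _ := by rw [hη']; monoidal)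
    evaluation_coevaluation' := hη } }⟩

end Dual

/-! ### The right adjoint of c ⊠ - and internal homs. -/

section BoxHom

variable {k : Type v} [Field k] {C : Type u} [Category.{v} C] [Preadditive C]
  [Linear k C] {P : Type u₁} [Category.{v} P] [Preadditive P] [Linear k P] {B : C ⥤ C ⥤ P}
  {c : C} {H : P ⥤ C} (adj : B.obj c ⊣ H)

/-- The morphism `y ⟶ H (a ⊠ y)` induced by `f : c ⟶ a`, for a right adjoint `H` of `c ⊠ -`. -/
def boxUnit {a : C} (f : c ⟶ a) (y : C) : y ⟶ H.obj ((B.obj a).obj y) :=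
  adj.homEquiv _ _ ((B.map f).app y)

/-- If `H` is right adjoint to `c ⊠ -`, then `H (a ⊠ y)` is the coproduct of copies of `y` indexed
by a basis of `Hom(c, a)`. -/
theorem IsBoxDense.nonempty_isColimit_boxUnit [HasColimitsOfSize.{v, v} C]
    (hB : IsBoxDense k (IsCompactProjective k) B)
    (hC : GeneratesUnderColimits (IsCompactProjective k (C := C)))
    (hc : IsCompactProjective k c) {a : C} {I : Type v} (b : Module.Basis I k (c ⟶ a)) (y : C) :
    Nonempty (IsColimit (Cofan.mk (H.obj ((B.obj a).obj y)) fun i => boxUnit adj (b i) y)) := by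
  have hq := colimit.isColimit (Discrete.functor fun _ : I => y)
  let ι (i : I) : y ⟶ colimit (Discrete.functor fun _ : I => y) :=
    colimit.ι (Discrete.functor fun _ : I => y) (Discrete.mk i)
  let κ := hq.desc (Cofan.mk (H.obj ((B.obj a).obj y)) fun i => boxUnit adj (b i) y)
  have hκ (i : I) : ι i ≫ κ = boxUnit adj (b i) y := hq.fac _ (Discrete.mk i)
  suffices IsIso κ from ⟨IsColimit.ofPointIso hq⟩
  refine hC.isIso κ fun w hw => ?_
  have := (hB.bicocontinuous.right c).additive
  have := (hB.bicocontinuous.right c).linear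
  -- Composition with `κ`, transposed along `adj` so as to be linear.
  let K : (w ⟶ colimit (Discrete.functor fun _ : I => y)) →ₗ[k]
      ((B.obj c).obj w ⟶ (B.obj a).obj y) :=
    Linear.rightComp k _ ((adj.homEquiv _ _).symm κ) ∘ₗ (B.obj c).mapLinearMap k
  have hK (h) : K h = (adj.homEquiv _ _).symm (h ≫ κ) :=
    (adj.homEquiv_naturality_left_symm h κ).symm
  suffices Function.Bijective K by
    have h : (fun g => g ≫ κ) = adj.homEquiv _ _ ∘ K := by
      ext g
      simp [hK]
    rw [h]
    exact (adj.homEquiv _ _).bijective.comp this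
  have hKι (i : I) (g : w ⟶ y) : K (g ≫ ι i) = boxTensor hB.bicocontinuous c a w y (b i ⊗ₜ g) := by
    rw [hK, Category.assoc, hκ, boxTensor_tmul, adj.homEquiv_naturality_left_symm, boxUnit,
      Equiv.symm_apply_apply]
    exact (B.map (b i)).naturality g
  let e := LinearEquiv.ofBijective _ (hB.bijective hc hw a y)
  -- Via Hom(c, a) ⊗ Hom(w, y) ≅ Hom(c ⊠ w, a ⊠ y), this is the inverse of `K`. That it is a left
  -- inverse is checked on maps factoring through one summand, which span since `w` is
  -- compact-projective; the basis may be infinite.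
  let Λ : (c ⟶ a) ⊗[k] (w ⟶ y) →ₗ[k] (w ⟶ colimit (Discrete.functor fun _ : I => y)) :=
    TensorProduct.lift (b.constr k fun i => Linear.rightComp k w (ι i))
  have hΛ (i : I) (g : w ⟶ y) : Λ (b i ⊗ₜ g) = g ≫ ι i := by
    simp [Λ]
  refine ⟨Function.LeftInverse.injective (g := Λ ∘ₗ e.symm.toLinearMap) fun h => ?_, fun t => ?_⟩
  · have htop := hw.eq_top_of_isColimit hq
      (LinearMap.eqLocus (Λ ∘ₗ e.symm.toLinearMap ∘ₗ K) LinearMap.id) (by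
        rintro ⟨i⟩ g
        have h1 : e.symm (K (g ≫ ι i)) = b i ⊗ₜ g := by
          rw [hKι]
          exact e.symm_apply_apply _
        exact (congrArg Λ h1).trans (hΛ i g))
    exact htop.ge (Submodule.mem_top (x := h))
  · have h1 : K ∘ₗ Λ = e.toLinearMap := by
      refine TensorProduct.ext (b.ext fun i => ?_)
      ext g
      exact (congrArg K (hΛ i g)).trans (hKι i g)
    exact ⟨Λ (e.symm t), (LinearMap.congr_fun h1 _).trans (e.apply_symm_apply t)⟩

namespace BoxAction

variable {T : P ⥤ C} (D : BoxAction k B T)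

/-- The canonical morphism `Ψ (H p) ⟶ H (act p)` for a right adjoint `H` of `c ⊠ -`. -/
def boxHomMap (d : C) : H ⋙ D.Ψ.obj d ⟶ D.act d ⋙ H where
  app p := adj.homEquiv _ _ (((D.actIso d).inv.app c).app (H.obj p) ≫
    (D.act d).map (adj.counit.app p))
  naturality p p' f := by
    have h1 := ((D.actIso d).inv.app c).naturality (H.map f)
    have h2 := congrArg (D.act d).map (adj.counit.naturality f)
    dsimp at h1 h2 ⊢
    rw [← adj.homEquiv_naturality_left, ← adj.homEquiv_naturality_right, reassoc_of% h1,
      Category.assoc, ← Functor.map_comp, ← Functor.map_comp]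
    exact congrArg _ (congrArg _ h2)

/-- The comparison map matches the coproduct injections of H(a ⊠ y) with those of H(a ⊠ Ψ_d(y)). -/
theorem boxUnit_boxHomMap (d : C) {a : C} (f : c ⟶ a) (y : C) :
    (D.Ψ.obj d).map (boxUnit adj f y) ≫ (D.boxHomMap adj d).app ((B.obj a).obj y) ≫
      H.map (((D.actIso d).hom.app a).app y) = boxUnit adj f ((D.Ψ.obj d).obj y) := by
  have h1 := ((D.actIso d).inv.app c).naturality (boxUnit adj f y)
  have h2 := congrArg (fun t => t.app y) ((D.actIso d).inv.naturality f)
  have h3 := congrArg (fun t => (t.app a).app y) (D.actIso d).inv_hom_id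
  have h4 : (B.obj c).map (boxUnit adj f y) ≫ adj.counit.app ((B.obj a).obj y) =
      (B.map f).app y :=
    (adj.homEquiv_counit _ _ _).symm.trans ((adj.homEquiv _ _).symm_apply_apply _)
  dsimp [boxHomMap] at h1 h2 h3 ⊢
  rw [← adj.homEquiv_naturality_right, ← adj.homEquiv_naturality_left, Category.assoc,
    reassoc_of% h1, ← Functor.map_comp_assoc, h4, ← reassoc_of% h2, h3]
  exact congrArg _ (Category.comp_id _)

/-- `H` is cocontinuous because c ⊠ - preserves compact projectives, so p = a ⊠ y suffices. There
both sides are the coproduct of copies of Ψ_d(y) indexed by a basis of Hom(c, a). -/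
theorem isIso_boxHomMap [HasColimitsOfSize.{v, v} C] [HasColimitsOfSize.{v, v} P]
    (hB : IsBoxDense k (IsCompactProjective k) B)
    (hC : GeneratesUnderColimits (IsCompactProjective k (C := C)))
    (hc : IsCompactProjective k c) (d : C) (p : P) : IsIso ((D.boxHomMap adj d).app p) := by
  have := (hB.bicocontinuous.right c).additive
  have := (hB.bicocontinuous.right c).linear
  have : PreservesColimitsOfSize.{v, v} H := preservesColimits_rightAdjoint (k := k) adj hC
    (fun _ h => h) fun _ h => hB.isCompactProjective hc h
  have := (D.isBicocontinuous.right d).preservesColimits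
  have := (D.isCocontinuous_act d).preservesColimits
  refine hB.generates.isIso_app (D.boxHomMap adj d) ?_ p
  rintro _ ⟨a, y, -, -⟩
  let b := Module.Free.chooseBasis k (c ⟶ a)
  obtain ⟨h1⟩ := hB.nonempty_isColimit_boxUnit adj hC hc b y
  obtain ⟨h2⟩ := hB.nonempty_isColimit_boxUnit adj hC hc b ((D.Ψ.obj d).obj y)
  have h3 := isColimitCofanMkObjOfIsColimit (D.Ψ.obj d) _ _ h1
  have h4 : (D.boxHomMap adj d).app ((B.obj a).obj y) ≫
      H.map (((D.actIso d).hom.app a).app y) = (h3.coconePointUniqueUpToIso h2).hom := by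
    refine Cofan.IsColimit.hom_ext h3 _ _ fun i => ?_
    exact (D.boxUnit_boxHomMap adj d (b i) y).trans
      (h3.comp_coconePointUniqueUpToIso_hom h2 (Discrete.mk i)).symm
  have : IsIso ((D.boxHomMap adj d).app ((B.obj a).obj y) ≫
      H.map (((D.actIso d).hom.app a).app y)) := h4 ▸ inferInstance
  exact IsIso.of_isIso_comp_right _ (H.map (((D.actIso d).hom.app a).app y))

/-- If the lax structure of the right adjoint of `T` is strong, then a compact-projective object
`c` has internal homs out of `M (c, -)`, compatible with the action. -/
theorem exists_bijective [HasColimitsOfSize.{v, v} C] [IsLocallyPresentable.{v} C]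
    [HasColimitsOfSize.{v, v} P] (hB : IsBoxDense k (IsCompactProjective k) B)
    (hC : GeneratesUnderColimits (IsCompactProjective k (C := C)))
    (hc : IsCompactProjective k c) {R : C ⥤ P} (adjT : T ⊣ R)
    (hR : ∀ d m, IsIso (D.lax adjT d m)) (u : C) :
    ∃ (h : C) (ev : (D.M.obj c).obj h ⟶ u), ∀ d x : C, Function.Bijective
      (fun f : x ⟶ (D.Ψ.obj d).obj h =>
        (D.M.obj c).map f ≫ (D.assoc d c h).hom ≫ (D.Ψ.obj d).map ev) := by
  have := (hB.bicocontinuous.right c).preservesColimits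
  have := isLeftAdjoint_of_isLocallyPresentable (B.obj c)
  have adj := Adjunction.ofIsLeftAdjoint (B.obj c)
  generalize Functor.rightAdjoint (B.obj c) = H at adj
  let ev : (D.M.obj c).obj (H.obj (R.obj u)) ⟶ u := (D.τ.inv.app c).app _ ≫
    T.map (adj.counit.app (R.obj u)) ≫ adjT.counit.app u
  refine ⟨H.obj (R.obj u), ev, fun d x => ?_⟩
  have := D.isIso_boxHomMap adj hB hC hc d (R.obj u)
  have := hR d u
  have hpost {x y z : C} (g : y ⟶ z) [IsIso g] : Function.Bijective (fun f : x ⟶ y => f ≫ g) :=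
    ⟨fun _ _ h => (cancel_mono g).1 h, fun f => ⟨f ≫ inv g, by simp⟩⟩
  have hpost' : Function.Bijective (fun f : (B.obj c).obj x ⟶ _ => f ≫ D.lax adjT d u) :=
    ⟨fun _ _ h => (cancel_mono _).1 h, fun f => ⟨f ≫ inv (D.lax adjT d u), by simp⟩⟩
  have hpre : Function.Bijective (fun f : T.obj ((B.obj c).obj x) ⟶ (D.Ψ.obj d).obj u =>
      (D.τ.inv.app c).app x ≫ f) :=
    ⟨fun _ _ h => (cancel_epi _).1 h, fun f => ⟨inv ((D.τ.inv.app c).app x) ≫ f, by simp⟩⟩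
  -- The chain Hom(x, Ψ_d(HRu)) ≅ Hom(x, H(act_d(Ru))) ≅ Hom(c ⊠ x, act_d(Ru)) ≅ Hom(c ⊠ x,
  -- R(Ψ_d(u))) ≅ Hom(T(c ⊠ x), Ψ_d(u)) ≅ Hom(M(c, x), Ψ_d(u)), whose third step is strength of `R`.
  have key := hpre.comp ((adjT.homEquiv _ _).symm.bijective.comp (hpost'.comp
    ((adj.homEquiv _ _).symm.bijective.comp (hpost ((D.boxHomMap adj d).app (R.obj u))))))
  refine (congrArg Function.Bijective (funext fun f => ?_)).mpr key
  have h1 := (D.σ d).hom.naturality (adj.counit.app (R.obj u))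
  have h2 := (D.τ.inv.app c).naturality f
  have h3 := congrArg (fun t => (t.app c).app ((D.Ψ.obj d).obj (H.obj (R.obj u))))
    D.τ.inv_hom_id
  have h4 := congrArg (fun t => (t.app c).app (H.obj (R.obj u))) (D.actIso d).inv_hom_id
  dsimp [boxHomMap, lax] at h1 h2 h3 h4 ⊢
  have h5 : T.map (((D.actIso d).inv.app c).app (H.obj (R.obj u))) ≫
      T.map (((D.actIso d).hom.app c).app (H.obj (R.obj u))) = 𝟙 _ :=
    (T.map_comp _ _).symm.trans ((congrArg T.map h4).trans (T.map_id _))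
  rw [adj.homEquiv_naturality_left_symm, Equiv.symm_apply_apply,
    adjT.homEquiv_naturality_left_symm, Equiv.symm_apply_apply]
  simp only [T.map_comp, Category.assoc]
  rw [reassoc_of% h1, D.σ_app]
  simp only [Category.assoc]
  rw [reassoc_of% h5, ← reassoc_of% h2, reassoc_of% h3]
  simp [ev]

end BoxAction

end BoxHom

/-- Internal homs into the unit are duals: strength for the right action yields the left dual, and
strength for the left action, with ⊠ flipped, the right dual. -/
theorem DeligneKellyProduct.HasStrongRightAdjoint.isDualizable {k : Type v} [Field k]
    {C : Type (v + 1)} [Category.{v} C] [Preadditive C] [Linear k C] [MonoidalCategory C]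
    [IsTensorCategory k C] (hC : HasEnoughCompactProjectives k C) {P : DeligneKellyProduct k C C}
    (hP : P.HasStrongRightAdjoint) {c : C} (hc : IsCompactProjective k c) : IsDualizable c := by
  obtain ⟨R, adj, -, hleft, hright⟩ := hP
  have := hC.hasColimits
  have := hasColimits_of_isLocallyPresentable P.obj
  have : IsLocallyPresentable.{v} C := IsTensorCategory.locallyPresentable k
  have hB := P.isBoxDense hC
  obtain ⟨S, -, hS, hS'⟩ := hC.exists_generators
  have hgen := hS'.mono hS
  obtain ⟨_, ev, h⟩ := P.rightAction.exists_bijective hB hgen hc adj hright (𝟙_ C)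
  obtain ⟨_, ev', h'⟩ := P.leftAction.exists_bijective hB.flip hgen hc adj hleft (𝟙_ C)
  exact ⟨nonempty_hasLeftDual ev h, nonempty_hasRightDual ev' h'⟩

end TensorCat

theorem mainTheorem5 (k : Type v) [Field k] (C : Type (v + 1)) [Category.{v} C] [Preadditive C]
    [Linear k C] [MonoidalCategory C] [TensorCat.IsTensorCategory k C]
    (hC : TensorCat.HasEnoughCompactProjectives k C) :
    Nonempty (TensorCat.DeligneKellyProduct k C C) ∧
    ∀ P : TensorCat.DeligneKellyProduct k C C,
      List.TFAE [
        ∀ c : C, TensorCat.IsCompactProjective k c → TensorCat.IsDualizable c,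
        ∃ S : ObjectProperty C, TensorCat.GeneratesUnderColimits S ∧
          ∀ c, S c → TensorCat.IsCompactProjective k c ∧ TensorCat.IsDualizable c,
        P.HasStrongRightAdjoint] := by
  refine ⟨hC.nonempty_deligneKellyProduct, fun P => ?_⟩
  tfae_have 1 → 2 := fun h => by
    obtain ⟨S, -, hS, hS'⟩ := hC.exists_generators
    exact ⟨S, hS', fun c hc => ⟨hS c hc, h c (hS c hc)⟩⟩
  tfae_have 2 → 3 := fun ⟨S, hS, h⟩ => P.hasStrongRightAdjoint hC hS h
  tfae_have 3 → 1 := fun h c hc => h.isDualizable hC hc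
  tfae_finish
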